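/- Around each point $u$ of the plane consider the six cones with apex $u$ bounded by the rays at consecutive multiples of $\pi/3$ from the positive $x$-axis. In counter-clockwise order starting at the positive $x$-axis, the first, third and fifth are called negative and the second, fourth and sixth positive. Let $P$ be a finite set of points in the plane such that no two of its points lie on a line parallel to a cone boundary. The half-$\theta_6$-graph of $P$ has vertex set $P$, and each $u\in P$ is joined by an edge, in each of its positive cones that contains another point of $P$, to the point of $P$ in this cone whose orthogonal projection onto the bisector of the cone is closest to $u$. Edges have their Euclidean length. A deterministic $k$-local $0$-memory routing algorithm chooses the vertex to which a message is forwarded as a function of the current vertex $s$, the destination $t$ (both given by their coordinates), and the set $N_k(s)$ of vertices reachable from $s$ by at most $k$ edges. It is $d$-competitive, for a class of pairs (source, destination), if on the half-$\theta_6$-graph of every such $P$ and for every pair of distinct vertices in the class, the message follows edges of the graph, reaches its destination, and travels a total distance of at most $d$ times the Euclidean distance between source and destination. Its routing ratio for this class is the smallest $d$ for which it is $d$-competitive. The spanning ratio of the half-$\theta_6$-graph is the smallest $r \ge 1$ such that for every such $P$ and all $u,v\in P$ the shortest path between $u$ and $v$ in the half-$\theta_6$-graph of $P$ has length at most $r\,|uv|$.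 Corollary. There is a deterministic $1$-local $0$-memory routing algorithm on the half-$\theta_6$-graph with routing ratio i) $2$ when the destination lies in a positive cone of the source, ii) $5/\sqrt3 = 2.886\ldots$ when the destination lies in a negative cone of the source, and hence with routing ratio $5/\sqrt3$ over all pairs. Both ratios are best possible: for every constant $k$, if a deterministic $k$-local $0$-memory routing algorithm is $d$-competitive for destinations in a positive cone of the source, then $d\ge 2$, and if it is $d$-competitive for destinations in a negative cone of the source, then $d\ge 5/\sqrt3$. In particular, the spanning ratio of the half-$\theta_6$-graph is $2 < 5/\sqrt3$, so every deterministic $k$-local $0$-memory routing algorithm that is $d$-competitive over all pairs has $d$ strictly larger than the spanning ratio. -/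

import Mathlib

noncomputable section

namespace HalfTheta

/-- The Euclidean plane. Vertices are identified with their coordinates. -/
abbrev Plane : Type := EuclideanSpace ℝ (Fin 2)

/-- The unit vector at angle `θ`, counter-clockwise from the positive `x`-axis. -/
def dir (θ : ℝ) : Plane := !₂[Real.cos θ, Real.sin θ]

/-- The (closed) cone with apex `u` between the rays at angles `m * π / 3` and
`(m + 1) * π / 3`. For `m = 0, …, 5` these are the six cones around `u`, in counter-clockwise
order starting from the positive `x`-axis. -/
def cone (u : Plane) (m : ℕ) : Set Plane :=
  {v | ∃ a b : ℝ, 0 ≤ a ∧ 0 ≤ b ∧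
    v = u + a • dir (m * (Real.pi / 3)) + b • dir ((m + 1) * (Real.pi / 3))}

/-- The direction of the bisector of `cone u m`. -/
def bisector (m : ℕ) : Plane := dir (m * (Real.pi / 3) + Real.pi / 6)

/-- The three positive cones of `u`: the second, fourth and sixth cone. -/
def positiveCone (u : Plane) (i : Fin 3) : Set Plane := cone u (2 * (i : ℕ) + 1)

/-- The three negative cones of `u`: the first, third and fifth cone. -/
def negativeCone (u : Plane) (i : Fin 3) : Set Plane := cone u (2 * (i : ℕ))

/-- `v` lies in a positive cone of `u`. -/
def InPositiveCone (u v : Plane) : Prop := ∃ i, v ∈ positiveCone u i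

/-- `v` lies in a negative cone of `u`. -/
def InNegativeCone (u v : Plane) : Prop := ∃ i, v ∈ negativeCone u i

/-- No two points of `P` lie on a line parallel to a cone boundary. -/
def GeneralPosition (P : Finset Plane) : Prop :=
  ∀ p ∈ P, ∀ q ∈ P, p ≠ q → ∀ (m : ℕ) (c : ℝ), q - p ≠ c • dir (m * (Real.pi / 3))

/-- `v` is the vertex of `P` in the `i`-th positive cone of `u` whose projection on the bisector
of that cone is closest to `u`. -/
def IsClosest (P : Finset Plane) (u : Plane) (i : Fin 3) (v : Plane) : Prop :=
  v ∈ P ∧ v ≠ u ∧ v ∈ positiveCone u i ∧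
    ∀ x ∈ P, x ≠ u → x ∈ positiveCone u i →
      inner ℝ (v - u) (bisector (2 * (i : ℕ) + 1)) ≤ inner ℝ (x - u) (bisector (2 * (i : ℕ) + 1))

/-- The half-`θ₆`-graph of `P`: every vertex has an edge to the closest vertex in each of its
positive cones. (As a graph on the whole plane, whose edges all join points of `P`.) -/
def halfThetaSix (P : Finset Plane) : SimpleGraph Plane where
  Adj u v := (u ∈ P ∧ ∃ i, IsClosest P u i v) ∨ (v ∈ P ∧ ∃ i, IsClosest P v i u)
  symm := ⟨fun _ _ h => h.symm⟩
  loopless := ⟨fun _ h => by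
    rcases h with ⟨_, _, _, h, _⟩ | ⟨_, _, _, h, _⟩ <;> exact h rfl⟩

/-- The set of vertices that can be reached from `s` by following at most `k` edges. -/
def kNeighborhood (P : Finset Plane) (k : ℕ) (s : Plane) : Set Plane :=
  {v | ∃ p : (halfThetaSix P).Walk s v, p.length ≤ k}

/-- A deterministic `0`-memory local forwarding rule: the vertex to which a message is forwarded
is a function of the current vertex, the destination and the neighborhood of the current
vertex. It is run as a `k`-local algorithm by feeding it `k`-neighborhoods. -/
abbrev RoutingAlgorithm : Type := Plane → Plane → Set Plane → Plane

/-- The position after `n` steps of a message sent from `s` to `t`, when `A` is run as a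
`k`-local algorithm on the half-`θ₆`-graph of `P`. -/
def position (k : ℕ) (A : RoutingAlgorithm) (P : Finset Plane) (s t : Plane) (n : ℕ) : Plane :=
  (fun x => A x t (kNeighborhood P k x))^[n] s

/-- The message sent from `s` to `t` only follows edges, reaches `t`, and has travelled a total
distance of at most `L` when it first does so. -/
def DeliversWithin (k : ℕ) (A : RoutingAlgorithm) (P : Finset Plane) (s t : Plane) (L : ℝ) :
    Prop :=
  ∃ n : ℕ, position k A P s t n = t ∧
    (∀ i < n, position k A P s t i ≠ t ∧
      (halfThetaSix P).Adj (position k A P s t i) (position k A P s t (i + 1))) ∧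
    ∑ i ∈ Finset.range n, dist (position k A P s t i) (position k A P s t (i + 1)) ≤ L

/-- `A`, run as a `k`-local algorithm on half-`θ₆`-graphs, is `d`-competitive for the
source-destination pairs in the relation `R`. -/
def IsCompetitive (k : ℕ) (A : RoutingAlgorithm) (R : Plane → Plane → Prop) (d : ℝ) : Prop :=
  ∀ P : Finset Plane, GeneralPosition P → ∀ s ∈ P, ∀ t ∈ P, s ≠ t → R s t →
    DeliversWithin k A P s t (d * dist s t)

/-- The routing ratio: the smallest `d` for which the algorithm is `d`-competitive. -/
def HasRoutingRatio (k : ℕ) (A : RoutingAlgorithm) (R : Plane → Plane → Prop) (d : ℝ) : Prop :=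
  IsLeast {d' : ℝ | IsCompetitive k A R d'} d

/-- The Euclidean length of a walk. -/
def walkLength {G : SimpleGraph Plane} {u v : Plane} (p : G.Walk u v) : ℝ :=
  (p.darts.map fun e => dist e.fst e.snd).sum

/-- The distance in a geometric graph: the length of a shortest path (`∞` if there is none). -/
def graphDist (G : SimpleGraph Plane) (u v : Plane) : ENNReal :=
  ⨅ p : G.Walk u v, ENNReal.ofReal (walkLength p)

/-- `r` is the spanning ratio of the half-`θ₆`-graph: the smallest `r ≥ 1` such that, for every
finite point set, the half-`θ₆`-graph is an `r`-spanner of the complete Euclidean graph. -/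
def IsSpanningRatio (r : ℝ) : Prop :=
  IsLeast {r' : ℝ | 1 ≤ r' ∧ ∀ P : Finset Plane, GeneralPosition P → ∀ u ∈ P, ∀ v ∈ P,
    graphDist (halfThetaSix P) u v ≤ ENNReal.ofReal (r' * dist u v)} r

end HalfTheta

end

/-!
In the coordinates along the three bisectors of the positive cones, which add up to zero, every
cone is given by two inequalities between coordinates and an edge minimizes the third coordinate, so
that all arguments become linear inequalities.

If `u` lies in a positive cone of `t`, the canonical triangle of `t` and `u` is the equilateral
triangle cut off from this cone by the line through `u` perpendicular to the bisector. For the upper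
bound, every position `u` of the message is assigned a budget that pays for the rest of its route.
If the destination `t` lies in a negative cone of `u`, let `a` be the side length of the triangle
and `x ≤ y` the lengths of the parts into which `u` divides its side: the budget is `2 * a + x`,
which drops to `a` plus the length of the other part once the points near one of the two far corners
are known to be absent. If `t` lies in a positive cone of `u`, the budget is the side length plus
the larger part. Comparing budgets and distances yields the two ratios.

For the lower bounds, almost equilateral configurations leave only long detours. The one for
negative cones is a long zigzag between two corners of a triangle whose far end is attached to the
destination. The source does not see the far end, so that the first step goes to the wrong corner
for one of the two parities of the length of the zigzag.
-/

noncomputable section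

namespace HalfTheta

/-- `Distinct i j k` says that `i`, `j`, `k` are the three indices `0`, `1`, `2` in some order, so
that a statement about one cone and the two others is proved for all six orders at once. -/
def Distinct (i j k : Fin 3) : Prop := i ≠ j ∧ i ≠ k ∧ j ≠ k

theorem Distinct.swap {i j k : Fin 3} (h : Distinct i j k) : Distinct i k j :=
  ⟨h.2.1, h.1, h.2.2.symm⟩

theorem Distinct.rotate {i j k : Fin 3} (h : Distinct i j k) : Distinct j k i :=
  ⟨h.2.2, h.1.symm, h.2.1.symm⟩

theorem Distinct.eq_or {i j k : Fin 3} (h : Distinct i j k) (l : Fin 3) :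
    l = i ∨ l = j ∨ l = k := by
  revert i j k l; unfold Distinct; decide

theorem Distinct.eq_add_one_add_two_or {i j k : Fin 3} (h : Distinct i j k) :
    j = i + 1 ∧ k = i + 2 ∨ j = i + 2 ∧ k = i + 1 := by
  revert i j k; unfold Distinct; decide

theorem distinct_add_one_add_two (i : Fin 3) : Distinct i (i + 1) (i + 2) := by
  revert i; unfold Distinct; decide

theorem Distinct.add_add_eq_sum {M : Type*} [AddCommMonoid M] {i j k : Fin 3}
    (h : Distinct i j k) (f : Fin 3 → M) : f i + f j + f k = ∑ l, f l := by
  rw [Fin.sum_univ_three]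
  rcases h.eq_add_one_add_two_or with ⟨rfl, rfl⟩ | ⟨rfl, rfl⟩ <;> fin_cases i <;>
    simp only [Fin.zero_eta, Fin.mk_one, Fin.reduceFinMk, Fin.reduceAdd, zero_add] <;> abel

/-- The triangular coordinates of the plane: `coord i` is the position along the bisector of the
`i`-th positive cone, scaled so that the equilateral triangle cut off from this cone at
`coord i = a` has side length `a`. -/
def coord (i : Fin 3) : Plane →ₗ[ℝ] ℝ := (2 / √3) • innerₗ Plane (bisector (2 * (i : ℕ) + 1))

theorem inner_dir_dir (α β : ℝ) : inner ℝ (dir α) (dir β) = Real.cos (β - α) := by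
  simp [dir, PiLp.inner_apply, Fin.sum_univ_two, Real.cos_sub]

theorem bisector_two_mul_add_one (n : ℕ) :
    bisector (2 * n + 1) = dir (n * (2 * Real.pi / 3) + Real.pi / 2) := by
  rw [bisector]
  congr 1
  push_cast
  ring

theorem coord_dir (i : Fin 3) (θ : ℝ) :
    coord i (dir θ) = 2 / √3 * Real.sin (θ - (i : ℕ) * (2 * Real.pi / 3)) := by
  rw [coord, LinearMap.smul_apply, innerₗ_apply_apply, smul_eq_mul, bisector_two_mul_add_one,
    inner_dir_dir, ← Real.cos_sub_pi_div_two, sub_add_eq_sub_sub]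

theorem coord_add_one_dir (i : Fin 3) (θ : ℝ) :
    coord (i + 1) (dir θ) = coord i (dir (θ - 2 * Real.pi / 3)) := by
  simp only [coord_dir]
  fin_cases i
  · simp
  · congr 2
    simp only [Fin.mk_one, Fin.reduceAdd, Fin.coe_ofNat_eq_mod, Nat.mod_succ, Nat.cast_ofNat,
      Nat.cast_one]
    ring
  · rw [← Real.sin_sub_two_pi]
    congr 2
    simp only [Fin.reduceFinMk, Fin.reduceAdd, Fin.coe_ofNat_eq_mod, Nat.zero_mod, Nat.cast_zero,
      Nat.cast_ofNat]
    ring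

theorem coord_add_two_dir (i : Fin 3) (θ : ℝ) :
    coord (i + 2) (dir θ) = coord i (dir (θ - 4 * Real.pi / 3)) := by
  rw [show i + 2 = i + 1 + 1 from (by decide : ∀ i : Fin 3, i + 2 = i + 1 + 1) i,
    coord_add_one_dir, coord_add_one_dir]
  congr 2
  ring

theorem coord_apply (i : Fin 3) (p : Plane) :
    coord i p = ![2 / √3 * p 1, -p 0 - p 1 / √3, p 0 - p 1 / √3] i := by
  have bisector_one : bisector 1 = dir (Real.pi / 2) := by
    rw [bisector]; congr 1; push_cast; ring
  have bisector_three : bisector 3 = dir (Real.pi / 6 + Real.pi) := by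
    rw [bisector]; congr 1; push_cast; ring
  have bisector_five : bisector 5 = dir (2 * Real.pi - Real.pi / 6) := by
    rw [bisector]; congr 1; push_cast; ring
  rw [coord, LinearMap.smul_apply, innerₗ_apply_apply, smul_eq_mul]
  fin_cases i
  · simp [bisector_one, dir, PiLp.inner_apply]
  · simp only [Fin.mk_one, Nat.reduceAdd, mul_one, bisector_three, dir, Real.cos_add_pi,
      Real.cos_pi_div_six, Real.sin_add_pi, Real.sin_pi_div_six, PiLp.inner_apply,
      RCLike.inner_apply, Real.ringHom_apply, Fin.sum_univ_two, Matrix.cons_val]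
    field_simp
    ring
  · simp only [Fin.reduceFinMk, Nat.reduceMul, Nat.reduceAdd, bisector_five, dir,
      Real.cos_two_pi_sub, Real.cos_pi_div_six, Real.sin_two_pi_sub, Real.sin_pi_div_six,
      PiLp.inner_apply, RCLike.inner_apply, Real.ringHom_apply, Fin.sum_univ_two, Matrix.cons_val]
    field_simp
    ring

theorem coord_add_add {i j k : Fin 3} (h : Distinct i j k) (p : Plane) :
    coord i p + coord j p + coord k p = 0 := by
  rw [h.add_add_eq_sum fun l => coord l p, Fin.sum_univ_three]
  simp only [coord_apply, Matrix.cons_val]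
  ring

theorem norm_sq_eq_sum_coord_sq (p : Plane) : ‖p‖ ^ 2 = (∑ l, coord l p ^ 2) / 2 := by
  have h_sqrt : √3 ^ 2 = 3 := Real.sq_sqrt (by norm_num)
  rw [EuclideanSpace.norm_sq_eq, Fin.sum_univ_two, Fin.sum_univ_three]
  simp only [coord_apply, Real.norm_eq_abs, sq_abs, Matrix.cons_val]
  field_simp
  linear_combination (2 * p 1 ^ 2) * h_sqrt

theorem norm_sq_eq {i j k : Fin 3} (h : Distinct i j k) (p : Plane) :
    ‖p‖ ^ 2 = coord j p ^ 2 + coord j p * coord k p + coord k p ^ 2 := by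
  have h_coord : coord i p = -coord j p - coord k p := by linarith [coord_add_add h p]
  rw [norm_sq_eq_sum_coord_sq, ← h.add_add_eq_sum fun l => coord l p ^ 2, h_coord]
  ring

theorem dist_sq_eq {i j k : Fin 3} (h : Distinct i j k) (p q : Plane) :
    dist p q ^ 2 = (coord j q - coord j p) ^ 2
      + (coord j q - coord j p) * (coord k q - coord k p) + (coord k q - coord k p) ^ 2 := by
  rw [dist_comm, dist_eq_norm, norm_sq_eq h, map_sub, map_sub]

theorem ext_coord {i j k : Fin 3} (h : Distinct i j k) {p q : Plane}
    (hj : coord j p = coord j q) (hk : coord k p = coord k q) : p = q := by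
  have h_dist := dist_sq_eq h p q
  rw [hj, hk] at h_dist
  simpa using h_dist

theorem half_sub_le_dist {i j k : Fin 3} (h : Distinct i j k) (u v : Plane) :
    ((coord j v - coord j u) - (coord k v - coord k u)) / 2 ≤ dist u v := by
  refine le_of_sq_le_sq ?_ dist_nonneg
  rw [dist_sq_eq h]
  nlinarith [sq_nonneg ((coord j v - coord j u) + (coord k v - coord k u))]

theorem mem_positiveCone_iff_add (u v : Plane) (i : Fin 3) :
    v ∈ positiveCone u i ↔
      coord (i + 1) v ≤ coord (i + 1) u ∧ coord (i + 2) v ≤ coord (i + 2) u := by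
  have h_sqrt : √3 ≠ 0 := by positivity
  set d := dir ((2 * (i : ℕ) + 1 : ℕ) * (Real.pi / 3)) with d_def
  set d' := dir (((2 * (i : ℕ) + 1 : ℕ) + 1) * (Real.pi / 3)) with d'_def
  have coord_one_d : coord (i + 1) d = -1 := by
    rw [d_def, coord_add_one_dir, coord_dir,
      show _ - _ - _ = -(Real.pi / 3) by push_cast; ring, Real.sin_neg, Real.sin_pi_div_three]
    field_simp
  have coord_two_d : coord (i + 2) d = 0 := by
    rw [d_def, coord_add_two_dir, coord_dir, show _ - _ - _ = -Real.pi by push_cast; ring,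
      Real.sin_neg, Real.sin_pi, neg_zero, mul_zero]
  have coord_one_d' : coord (i + 1) d' = 0 := by
    rw [d'_def, coord_add_one_dir, coord_dir, show _ - _ - _ = (0 : ℝ) by push_cast; ring,
      Real.sin_zero, mul_zero]
  have coord_two_d' : coord (i + 2) d' = -1 := by
    rw [d'_def, coord_add_two_dir, coord_dir,
      show _ - _ - _ = Real.pi / 3 - Real.pi by push_cast; ring, Real.sin_sub_pi,
      Real.sin_pi_div_three]
    field_simp
  constructor
  · rintro ⟨a, b, ha, hb, rfl⟩
    simp only [map_add, map_smul, smul_eq_mul, d_def.symm, d'_def.symm, coord_one_d, coord_two_d,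
      coord_one_d', coord_two_d']
    constructor <;> linarith
  · rintro ⟨h_one, h_two⟩
    refine ⟨coord (i + 1) u - coord (i + 1) v, coord (i + 2) u - coord (i + 2) v,
      sub_nonneg.2 h_one, sub_nonneg.2 h_two, ext_coord (distinct_add_one_add_two i) ?_ ?_⟩ <;>
    simp only [map_add, map_smul, smul_eq_mul, d_def.symm, d'_def.symm, coord_one_d, coord_two_d,
      coord_one_d', coord_two_d'] <;>
    ring

theorem mem_positiveCone_iff {i j k : Fin 3} (h : Distinct i j k) {u v : Plane} :
    v ∈ positiveCone u i ↔ coord j v ≤ coord j u ∧ coord k v ≤ coord k u := by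
  rw [mem_positiveCone_iff_add]
  rcases h.eq_add_one_add_two_or with ⟨rfl, rfl⟩ | ⟨rfl, rfl⟩
  · rfl
  · exact and_comm

theorem dir_add_pi (θ : ℝ) : dir (θ + Real.pi) = -dir θ := by
  ext i; fin_cases i <;> simp [dir]

theorem mem_cone_add_three_iff (u v : Plane) (m : ℕ) : v ∈ cone u (m + 3) ↔ u ∈ cone v m := by
  have first : ((m + 3 : ℕ) : ℝ) * (Real.pi / 3) = m * (Real.pi / 3) + Real.pi := by
    push_cast; ring
  have second : (((m + 3 : ℕ) : ℝ) + 1) * (Real.pi / 3) = (m + 1) * (Real.pi / 3) + Real.pi := by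
    push_cast; ring
  simp only [cone, Set.mem_ofPred_eq, first, second, dir_add_pi]
  constructor <;>
  · rintro ⟨a, b, ha, hb, rfl⟩
    exact ⟨a, b, ha, hb, by module⟩

theorem cone_add_six (u : Plane) (m : ℕ) : cone u (m + 6) = cone u m := by
  ext v
  rw [show m + 6 = m + 3 + 3 from rfl, mem_cone_add_three_iff, mem_cone_add_three_iff]

theorem mem_negativeCone_iff (u v : Plane) (i : Fin 3) :
    v ∈ negativeCone u i ↔ u ∈ positiveCone v (i + 1) := by
  rw [negativeCone, ← cone_add_six, mem_cone_add_three_iff, positiveCone]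
  fin_cases i
  · rfl
  · rfl
  · exact iff_of_eq (congrArg (u ∈ ·) (cone_add_six v 1))

theorem inNegativeCone_iff (u v : Plane) : InNegativeCone u v ↔ InPositiveCone v u := by
  simp only [InNegativeCone, mem_negativeCone_iff]
  exact (Equiv.addRight (1 : Fin 3)).exists_congr_left.trans (by simp [InPositiveCone])

/-! ### Point sets in general position -/

theorem exists_coord_dir_eq_zero (m : ℕ) : ∃ i, coord i (dir (m * (Real.pi / 3))) = 0 := by
  obtain ⟨q, hq⟩ : ∃ q : ℕ, 2 * m % 3 + 3 * q = 2 * m := ⟨_, Nat.mod_add_div _ _⟩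
  have h_mod : ((2 * m % 3 : ℕ) : ℝ) = 2 * m - 3 * q := by
    rw [eq_sub_iff_add_eq]
    exact_mod_cast hq
  refine ⟨Fin.ofNat 3 (2 * m), ?_⟩
  rw [coord_dir, Fin.val_ofNat, h_mod,
    show _ - _ = ((2 * q - m : ℤ) : ℝ) * Real.pi by push_cast; ring, Real.sin_int_mul_pi, mul_zero]

theorem exists_eq_smul_dir_of_coord_eq_zero {i : Fin 3} {p : Plane} (h : coord i p = 0) :
    ∃ c : ℝ, p = c • dir ((2 * i : ℕ) * (Real.pi / 3)) := by
  have h_angle : ((2 * i : ℕ) : ℝ) * (Real.pi / 3) = (i : ℕ) * (2 * Real.pi / 3) := by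
    push_cast; ring
  have h_sqrt : √3 ≠ 0 := by positivity
  refine ⟨-coord (i + 1) p, ext_coord (distinct_add_one_add_two i).rotate.rotate ?_ ?_⟩
  · rw [map_smul, h, coord_dir, h_angle, sub_self, Real.sin_zero, mul_zero, smul_zero]
  · rw [map_smul, coord_add_one_dir, coord_dir, h_angle,
      show _ - _ - _ = Real.pi / 3 - Real.pi by ring, Real.sin_sub_pi, Real.sin_pi_div_three]
    field_simp
    simp

theorem generalPosition_iff_injOn (P : Finset Plane) :
    GeneralPosition P ↔ ∀ i, Set.InjOn (coord i) P := by
  constructor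
  · intro hP i p hp q hq h_eq
    by_contra hne
    obtain ⟨c, hc⟩ := exists_eq_smul_dir_of_coord_eq_zero
      (show coord i (q - p) = 0 by rw [map_sub, h_eq, sub_self])
    exact hP p hp q hq hne _ c hc
  · intro h_inj p hp q hq hne m c h_eq
    obtain ⟨i, hi⟩ := exists_coord_dir_eq_zero m
    have h_zero : coord i q - coord i p = 0 := by rw [← map_sub, h_eq, map_smul, hi, smul_zero]
    exact hne (h_inj i hp hq (sub_eq_zero.1 h_zero).symm)

theorem GeneralPosition.coord_lt_of_le {P : Finset Plane} (hP : GeneralPosition P) {p q : Plane}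
    (hp : p ∈ P) (hq : q ∈ P) (hne : p ≠ q) {i : Fin 3} (hle : coord i p ≤ coord i q) :
    coord i p < coord i q :=
  hle.lt_of_ne fun h => hne ((generalPosition_iff_injOn P).1 hP i hp hq h)

/-- The open cone with apex `u` in which the coordinates `j` and `k` decrease. If `i` is the third
index, this is the interior of the `i`-th positive cone of `u`. -/
def openCone (j k : Fin 3) (u : Plane) : Set Plane :=
  {v | coord j v < coord j u ∧ coord k v < coord k u}

theorem mem_openCone_iff {j k : Fin 3} {u v : Plane} :
    v ∈ openCone j k u ↔ coord j v < coord j u ∧ coord k v < coord k u :=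
  Iff.rfl

theorem openCone_comm (j k : Fin 3) (u : Plane) : openCone j k u = openCone k j u :=
  Set.ext fun _ => and_comm

theorem ne_of_mem_openCone {j k : Fin 3} {u v : Plane} (h : v ∈ openCone j k u) : v ≠ u := by
  rintro rfl
  exact lt_irrefl _ h.1

theorem coord_lt_of_mem_openCone {i j k : Fin 3} (h : Distinct i j k) {u v : Plane}
    (hv : v ∈ openCone j k u) : coord i u < coord i v := by
  linarith [hv.1, hv.2, coord_add_add h u, coord_add_add h v]

theorem dist_le_of_mem_openCone {i j k : Fin 3} (h : Distinct i j k) {u v : Plane}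
    (hv : v ∈ openCone j k u) : dist u v ≤ coord i v - coord i u := by
  have h_sub : coord i v - coord i u = (coord j u - coord j v) + (coord k u - coord k v) := by
    linarith [coord_add_add h u, coord_add_add h v]
  refine le_of_sq_le_sq ?_ (sub_nonneg.2 (coord_lt_of_mem_openCone h hv).le)
  rw [dist_sq_eq h, h_sub]
  nlinarith [mul_pos (sub_pos.2 hv.1) (sub_pos.2 hv.2)]

theorem eq_or_eq_swap_of_mem_openCone {i j k i' j' k' : Fin 3} (h : Distinct i j k)
    (h' : Distinct i' j' k') {u v : Plane} (hv : v ∈ openCone j k u) (hv' : v ∈ openCone j' k' u) :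
    i' = i ∧ (j' = j ∧ k' = k ∨ j' = k ∧ k' = j) := by
  have hi := coord_lt_of_mem_openCone h hv
  have hj' : j' ≠ i := by rintro rfl; exact hi.not_gt hv'.1
  have hk' : k' ≠ i := by rintro rfl; exact hi.not_gt hv'.2
  clear hi hv hv'
  revert i j k i' j' k'
  unfold Distinct
  decide

theorem notMem_openCone_of_mem {i j k i' j' k' : Fin 3} (h : Distinct i j k)
    (h' : Distinct i' j' k') {u v : Plane} (hv : v ∈ openCone j k u) : u ∉ openCone j' k' v := by
  intro hu
  have eq_of_lt {l : Fin 3} (hl : coord l u < coord l v) : l = i := by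
    rcases h.eq_or l with rfl | rfl | rfl
    · rfl
    · exact absurd hl hv.1.not_gt
    · exact absurd hl hv.2.not_gt
  exact h'.2.2 ((eq_of_lt hu.1).trans (eq_of_lt hu.2).symm)

theorem GeneralPosition.mem_positiveCone_iff {P : Finset Plane} (hP : GeneralPosition P)
    {i j k : Fin 3} (h : Distinct i j k) {u v : Plane} (hu : u ∈ P) (hv : v ∈ P) (hne : v ≠ u) :
    v ∈ positiveCone u i ↔ v ∈ openCone j k u := by
  rw [HalfTheta.mem_positiveCone_iff h]
  exact ⟨fun hle => ⟨hP.coord_lt_of_le hv hu hne hle.1, hP.coord_lt_of_le hv hu hne hle.2⟩,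
    fun hlt => ⟨hlt.1.le, hlt.2.le⟩⟩

theorem GeneralPosition.exists_mem_openCone_of_inPositiveCone {P : Finset Plane}
    (hP : GeneralPosition P) {u v : Plane} (hu : u ∈ P) (hv : v ∈ P) (hne : v ≠ u)
    (huv : InPositiveCone u v) : ∃ i j k, Distinct i j k ∧ v ∈ openCone j k u := by
  obtain ⟨i, hi⟩ := huv
  have h := distinct_add_one_add_two i
  exact ⟨i, i + 1, i + 2, h, (hP.mem_positiveCone_iff h hu hv hne).1 hi⟩

theorem exists_distinct_iff (p : Fin 3 → Prop) : ∃ i j k, Distinct i j k ∧ (p j ↔ p k) := by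
  by_cases h_two : p 0 ↔ p 1
  · exact ⟨2, 0, 1, by unfold Distinct; decide, h_two⟩
  by_cases h_one : p 0 ↔ p 2
  · exact ⟨1, 0, 2, by unfold Distinct; decide, h_one⟩
  · exact ⟨0, 1, 2, by unfold Distinct; decide, by tauto⟩

theorem inPositiveCone_or_inNegativeCone (u v : Plane) :
    InPositiveCone u v ∨ InNegativeCone u v := by
  obtain ⟨i, j, k, h, h_iff⟩ := exists_distinct_iff fun l => coord l v ≤ coord l u
  by_cases hj : coord j v ≤ coord j u
  · exact .inl ⟨i, (mem_positiveCone_iff h).2 ⟨hj, h_iff.1 hj⟩⟩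
  · have hk : ¬coord k v ≤ coord k u := fun hk => hj (h_iff.2 hk)
    exact .inr ((inNegativeCone_iff u v).2
      ⟨i, (mem_positiveCone_iff h).2 ⟨(not_le.1 hj).le, (not_le.1 hk).le⟩⟩)

/-! ### Edges of the half-`θ₆`-graph -/

section Adjacency

variable {P : Finset Plane} {i j k : Fin 3} {u v : Plane}

theorem mem_of_adj (h : (halfThetaSix P).Adj u v) : v ∈ P := by
  rcases h with ⟨-, i, h⟩ | ⟨h, -⟩
  · exact h.1
  · exact h

theorem inner_bisector_le_iff (i : Fin 3) (u v w : Plane) :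
    inner ℝ (v - u) (bisector (2 * (i : ℕ) + 1)) ≤ inner ℝ (w - u) (bisector (2 * (i : ℕ) + 1)) ↔
      coord i v ≤ coord i w := by
  have h_coord (p : Plane) : coord i p = 2 / √3 * inner ℝ p (bisector (2 * (i : ℕ) + 1)) := by
    rw [real_inner_comm]; rfl
  rw [h_coord v, h_coord w, mul_le_mul_iff_right₀ (by positivity), inner_sub_left, inner_sub_left,
    sub_le_sub_iff_right]

theorem GeneralPosition.isClosest_iff (hP : GeneralPosition P) (h : Distinct i j k) (hu : u ∈ P) :
    IsClosest P u i v ↔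
      v ∈ P ∧ v ∈ openCone j k u ∧ ∀ x ∈ P, x ∈ openCone j k u → coord i v ≤ coord i x := by
  simp only [IsClosest, inner_bisector_le_iff]
  constructor
  · rintro ⟨hv, hne, h_cone, h_min⟩
    exact ⟨hv, (hP.mem_positiveCone_iff h hu hv hne).1 h_cone, fun x hx hxu =>
      h_min x hx (ne_of_mem_openCone hxu)
        ((hP.mem_positiveCone_iff h hu hx (ne_of_mem_openCone hxu)).2 hxu)⟩
  · rintro ⟨hv, h_cone, h_min⟩
    have hne := ne_of_mem_openCone h_cone
    exact ⟨hv, hne, (hP.mem_positiveCone_iff h hu hv hne).2 h_cone, fun x hx hxu hx_cone =>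
      h_min x hx ((hP.mem_positiveCone_iff h hu hx hxu).1 hx_cone)⟩

theorem GeneralPosition.adj_iff_forall_coord_le (hP : GeneralPosition P) (h : Distinct i j k)
    (hu : u ∈ P) (hv : v ∈ P) (hvu : v ∈ openCone j k u) :
    (halfThetaSix P).Adj u v ↔ ∀ x ∈ P, x ∈ openCone j k u → coord i v ≤ coord i x := by
  constructor
  · rintro (⟨-, l, h_closest⟩ | ⟨-, l, h_closest⟩)
    · have h_third := distinct_add_one_add_two l
      obtain rfl := (eq_or_eq_swap_of_mem_openCone h h_third hvu
        ((hP.isClosest_iff h_third hu).1 h_closest).2.1).1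
      exact ((hP.isClosest_iff h hu).1 h_closest).2.2
    · have h_third := distinct_add_one_add_two l
      exact absurd ((hP.isClosest_iff h_third hv).1 h_closest).2.1
        (notMem_openCone_of_mem h h_third hvu)
  · exact fun h_min => .inl ⟨hu, i, (hP.isClosest_iff h hu).2 ⟨hv, hvu, h_min⟩⟩

theorem GeneralPosition.exists_adj_mem_openCone (hP : GeneralPosition P) (h : Distinct i j k)
    (hu : u ∈ P) {x : Plane} (hx : x ∈ P) (hxu : x ∈ openCone j k u) :
    ∃ v ∈ P, v ∈ openCone j k u ∧ coord i v ≤ coord i x ∧ (halfThetaSix P).Adj u v := by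
  classical
  obtain ⟨v, hv, h_min⟩ := ({y ∈ P | y ∈ openCone j k u} : Finset Plane).exists_min_image (coord i)
    ⟨x, Finset.mem_filter.2 ⟨hx, hxu⟩⟩
  simp only [Finset.mem_filter, and_imp] at hv h_min
  exact ⟨v, hv.1, hv.2, h_min x hx hxu,
    (hP.adj_iff_forall_coord_le h hu hv.1 hv.2).2 h_min⟩

end Adjacency

/-! ### The routing algorithm -/

/-- For `s ∈ openCone j k t`, the `k`-th side of the canonical triangle of `t` and `s`: its points
in the `k`-th positive cone of `s`. -/
def side (s t : Plane) (i j k : Fin 3) : Set Plane :=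
  {x ∈ openCone i j s | coord k x ≤ coord k t}

/-- For `s ∈ openCone j k t`, the middle part of the canonical triangle of `t` and `s`: its points
in the negative cone of `s` that contains `t`. -/
def middle (s t : Plane) (j k : Fin 3) : Set Plane :=
  {x | s ∈ openCone j k x ∧ coord j x ≤ coord j t ∧ coord k x ≤ coord k t}

/-- The routing algorithm may forward a message for `t` from `s`, with neighborhood `N`, to `w`.
If `t` lies in a positive cone of `s`, the message follows the edge in this cone. Otherwise let the
sides and the middle refer to the canonical triangle of `t` and `s`. If both sides contain a
neighbor, the message goes to the smaller side. If one side (the larger one, if there is a choice)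
is empty, it goes to the neighbor in the middle that is closest to this side, and to the other side
if the middle contains no neighbor. -/
inductive ForwardingRule (s t : Plane) (N : Set Plane) (w : Plane) : Prop
  | positive {i j k : Fin 3} (h : Distinct i j k) (ht : t ∈ openCone j k s) (hN : w ∈ N)
      (hw : w ∈ openCone j k s)
  | bothSides {i j k : Fin 3} (h : Distinct i j k) (hs : s ∈ openCone j k t)
      (h_side : ∃ x ∈ N, x ∈ side s t i j k)
      (h_le : coord j t - coord j s ≤ coord k t - coord k s) (hN : w ∈ N)
      (hw : w ∈ side s t i k j)
  | middle {i j k : Fin 3} (h : Distinct i j k) (hs : s ∈ openCone j k t)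
      (h_side : ∀ x ∈ N, x ∉ side s t i j k)
      (h_other : (∃ x ∈ N, x ∈ side s t i k j) ∨ coord j t - coord j s ≤ coord k t - coord k s)
      (hN : w ∈ N) (hw : w ∈ middle s t j k)
      (h_min : ∀ x ∈ N, x ∈ middle s t j k → coord j w ≤ coord j x)
  | emptySide {i j k : Fin 3} (h : Distinct i j k) (hs : s ∈ openCone j k t)
      (h_side : ∀ x ∈ N, x ∉ side s t i j k) (h_middle : ∀ x ∈ N, x ∉ middle s t j k)
      (hN : w ∈ N) (hw : w ∈ side s t i k j)

open Classical in
/-- The routing algorithm that forwards to some vertex allowed by `ForwardingRule`. -/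
def router : RoutingAlgorithm := fun s t N =>
  if h : ∃ w, ForwardingRule s t N w then h.choose else s

theorem ForwardingRule.mem_and_ne {s t w : Plane} {N : Set Plane} (h : ForwardingRule s t N w) :
    w ∈ N ∧ w ≠ s := by
  rcases h with ⟨-, -, hN, hw⟩ | ⟨-, -, -, -, hN, hw⟩ | ⟨-, -, -, -, hN, hw, -⟩ |
    ⟨-, -, -, -, hN, hw⟩
  · exact ⟨hN, ne_of_mem_openCone hw⟩
  · exact ⟨hN, ne_of_mem_openCone hw.1⟩
  · exact ⟨hN, (ne_of_mem_openCone hw.1).symm⟩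
  · exact ⟨hN, ne_of_mem_openCone hw.1⟩

section Neighborhood

variable {P : Finset Plane} {s v : Plane}

theorem mem_kNeighborhood_zero : v ∈ kNeighborhood P 0 s ↔ v = s := by
  constructor
  · rintro ⟨p, hp⟩
    exact (SimpleGraph.Walk.eq_of_length_eq_zero (Nat.le_zero.1 hp)).symm
  · rintro rfl
    exact ⟨.nil, le_rfl⟩

theorem mem_kNeighborhood_succ {n : ℕ} :
    v ∈ kNeighborhood P (n + 1) s ↔
      v ∈ kNeighborhood P n s ∨ ∃ w ∈ kNeighborhood P n s, (halfThetaSix P).Adj w v := by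
  constructor
  · rintro ⟨p, hp⟩
    by_cases h_nil : p.Nil
    · exact .inl ⟨p, by simp [SimpleGraph.Walk.length_eq_zero_iff.2 h_nil]⟩
    · exact .inr ⟨p.penultimate, ⟨p.dropLast, by rw [SimpleGraph.Walk.length_dropLast]; omega⟩,
        p.adj_penultimate h_nil⟩
  · rintro (⟨p, hp⟩ | ⟨w, ⟨p, hp⟩, hadj⟩)
    · exact ⟨p, hp.trans n.le_succ⟩
    · exact ⟨p.concat hadj, by rw [SimpleGraph.Walk.length_concat]; omega⟩

theorem mem_kNeighborhood_one : v ∈ kNeighborhood P 1 s ↔ v = s ∨ (halfThetaSix P).Adj s v := by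
  simp only [mem_kNeighborhood_succ, mem_kNeighborhood_zero, exists_eq_left]

theorem kNeighborhood_subset (hs : s ∈ P) (n : ℕ) : kNeighborhood P n s ⊆ P := by
  intro v hv
  cases n with
  | zero => rwa [mem_kNeighborhood_zero.1 hv]
  | succ n =>
    induction n generalizing v with
    | zero => exact (mem_kNeighborhood_one.1 hv).elim (fun h => h ▸ hs) mem_of_adj
    | succ n ih => exact (mem_kNeighborhood_succ.1 hv).elim (ih ·) fun ⟨_, _, h⟩ => mem_of_adj h

end Neighborhood

theorem ForwardingRule.adj {P : Finset Plane} {s t w : Plane}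
    (h : ForwardingRule s t (kNeighborhood P 1 s) w) : (halfThetaSix P).Adj s w :=
  (mem_kNeighborhood_one.1 h.mem_and_ne.1).resolve_left h.mem_and_ne.2

section Triangle

variable {P : Finset Plane} {i j k : Fin 3} {s t u w : Plane}

theorem GeneralPosition.forall_notMem_side_iff (hP : GeneralPosition P) (h : Distinct i j k)
    (hs : s ∈ P) :
    (∀ x ∈ kNeighborhood P 1 s, x ∉ side s t i j k) ↔ ∀ x ∈ P, x ∉ side s t i j k := by
  constructor
  · intro h_side x hx hxs
    obtain ⟨v, -, hv, h_le, hadj⟩ := hP.exists_adj_mem_openCone h.rotate.rotate hs hx hxs.1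
    exact h_side v (mem_kNeighborhood_one.2 (.inr hadj)) ⟨hv, h_le.trans hxs.2⟩
  · exact fun h_side x hx => h_side x (kNeighborhood_subset hs 1 hx)

theorem GeneralPosition.exists_adj_mem_middle (hP : GeneralPosition P) (h : Distinct i j k)
    (hs : s ∈ P) (ht : t ∈ P) (hst : s ∈ openCone j k t)
    (h_side : ∀ x ∈ P, x ∉ side s t i j k) (h_side' : ∀ x ∈ P, x ∉ side s t i k j) :
    ∃ w, (halfThetaSix P).Adj s w ∧ w ∈ middle s t j k := by
  classical
  obtain ⟨w, hw, h_max⟩ :=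
    ({x ∈ P | x ∈ middle s t j k} : Finset Plane).exists_max_image (coord i)
      ⟨t, Finset.mem_filter.2 ⟨ht, hst, le_rfl, le_rfl⟩⟩
  simp only [Finset.mem_filter, and_imp] at hw h_max
  obtain ⟨hwP, hw⟩ := hw
  refine ⟨w, ((hP.adj_iff_forall_coord_le h hwP hs hw.1).2 fun x hx hxw => ?_).symm, hw⟩
  by_contra! h_lt
  have hne : s ≠ x := by rintro rfl; exact lt_irrefl _ h_lt
  have hxj : coord j x ≤ coord j t := hxw.1.le.trans hw.2.1
  have hxk : coord k x ≤ coord k t := hxw.2.le.trans hw.2.2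
  have hsj : coord j s < coord j x :=
    hP.coord_lt_of_le hs hx hne (not_lt.1 fun hj => h_side x hx ⟨⟨h_lt, hj⟩, hxk⟩)
  have hsk : coord k s < coord k x :=
    hP.coord_lt_of_le hs hx hne (not_lt.1 fun hk => h_side' x hx ⟨⟨h_lt, hk⟩, hxj⟩)
  exact (coord_lt_of_mem_openCone h hxw).not_ge (h_max x hx ⟨⟨hsj, hsk⟩, hxj, hxk⟩)

theorem GeneralPosition.forall_notMem_side_of_le (hP : GeneralPosition P) (h : Distinct i j k)
    (hs : s ∈ P) (h_side : ∀ x ∈ P, x ∉ side s t i j k) (hwi : coord i w < coord i s)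
    (hwj : coord j w ≤ coord j t)
    (h_cone : ∀ x ∈ P, x ∈ openCone i k s → coord j w ≤ coord j x)
    (h_min : ∀ x ∈ kNeighborhood P 1 s, x ∈ middle s t j k → coord j w ≤ coord j x) :
    ∀ y ∈ P, y ∉ side w t i j k := by
  rintro y hy ⟨⟨hyi, hyj⟩, hyk⟩
  have hys : coord i y < coord i s := hyi.trans hwi
  have hne : s ≠ y := by rintro rfl; exact lt_irrefl _ hys
  have hsj : coord j s < coord j y :=
    hP.coord_lt_of_le hs hy hne (not_lt.1 fun hj => h_side y hy ⟨⟨hys, hj⟩, hyk⟩)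
  have hsk : coord k s < coord k y :=
    hP.coord_lt_of_le hs hy hne (not_lt.1 fun hk => hyj.not_ge (h_cone y hy ⟨hys, hk⟩))
  obtain ⟨x, hadj, hxs, hxj, hxk⟩ := hP.exists_adj_mem_middle h hs hy ⟨hsj, hsk⟩
    (fun x hx hxy => h_side x hx ⟨hxy.1, hxy.2.trans hyk⟩)
    (fun x hx hxy => hyj.not_ge ((h_cone x hx hxy.1).trans hxy.2))
  have hwx : coord j w ≤ coord j x := h_min x (mem_kNeighborhood_one.2 (.inr hadj))
    ⟨hxs, hxj.trans (hyj.le.trans hwj), hxk.trans hyk⟩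
  linarith

theorem GeneralPosition.exists_forwardingRule_of_forall_notMem_side (hP : GeneralPosition P)
    (h : Distinct i j k) (hs : s ∈ P) (ht : t ∈ P) (hst : s ∈ openCone j k t)
    (h_side : ∀ x ∈ kNeighborhood P 1 s, x ∉ side s t i j k)
    (h_other : (∃ x ∈ kNeighborhood P 1 s, x ∈ side s t i k j) ∨
      coord j t - coord j s ≤ coord k t - coord k s) :
    ∃ w, ForwardingRule s t (kNeighborhood P 1 s) w := by
  by_cases h_middle : ∃ x ∈ kNeighborhood P 1 s, x ∈ HalfTheta.middle s t j k
  · have h_finite : (kNeighborhood P 1 s ∩ HalfTheta.middle s t j k).Finite :=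
      P.finite_toSet.subset (Set.inter_subset_left.trans (kNeighborhood_subset hs 1))
    obtain ⟨w, hw, h_min⟩ := Set.exists_min_image _ (coord j) h_finite h_middle
    exact ⟨w, .middle h hst h_side h_other hw.1 hw.2 fun x hN hx => h_min x ⟨hN, hx⟩⟩
  push Not at h_middle
  by_cases h_side' : ∃ x ∈ kNeighborhood P 1 s, x ∈ side s t i k j
  · obtain ⟨w, hN, hw⟩ := h_side'
    exact ⟨w, .emptySide h hst h_side h_middle hN hw⟩
  · push Not at h_side'
    obtain ⟨w, hadj, hw⟩ := hP.exists_adj_mem_middle h hs ht hst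
      ((hP.forall_notMem_side_iff h hs).1 h_side) ((hP.forall_notMem_side_iff h.swap hs).1 h_side')
    exact absurd hw (h_middle w (mem_kNeighborhood_one.2 (.inr hadj)))

theorem GeneralPosition.exists_forwardingRule_of_le (hP : GeneralPosition P) (h : Distinct i j k)
    (hs : s ∈ P) (ht : t ∈ P) (hst : s ∈ openCone j k t)
    (h_le : coord j t - coord j s ≤ coord k t - coord k s) :
    ∃ w, ForwardingRule s t (kNeighborhood P 1 s) w := by
  by_cases h_large : ∃ x ∈ kNeighborhood P 1 s, x ∈ side s t i j k
  · by_cases h_small : ∃ x ∈ kNeighborhood P 1 s, x ∈ side s t i k j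
    · obtain ⟨w, hN, hw⟩ := h_small
      exact ⟨w, .bothSides h hst h_large h_le hN hw⟩
    · push Not at h_small
      exact hP.exists_forwardingRule_of_forall_notMem_side h.swap hs ht (openCone_comm j k t ▸ hst)
        h_small (.inl h_large)
  · push Not at h_large
    exact hP.exists_forwardingRule_of_forall_notMem_side h hs ht hst h_large (.inr h_le)

theorem GeneralPosition.exists_forwardingRule (hP : GeneralPosition P) (hs : s ∈ P) (ht : t ∈ P)
    (hne : s ≠ t) : ∃ w, ForwardingRule s t (kNeighborhood P 1 s) w := by
  rcases inPositiveCone_or_inNegativeCone s t with hst | hst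
  · obtain ⟨i, j, k, h, hts⟩ := hP.exists_mem_openCone_of_inPositiveCone hs ht hne.symm hst
    obtain ⟨w, -, hw, -, hadj⟩ := hP.exists_adj_mem_openCone h hs ht hts
    exact ⟨w, .positive h hts (mem_kNeighborhood_one.2 (.inr hadj)) hw⟩
  · obtain ⟨i, j, k, h, hst⟩ := hP.exists_mem_openCone_of_inPositiveCone ht hs hne
      ((inNegativeCone_iff s t).1 hst)
    rcases le_total (coord j t - coord j s) (coord k t - coord k s) with h_le | h_le
    · exact hP.exists_forwardingRule_of_le h hs ht hst h_le
    · exact hP.exists_forwardingRule_of_le h.swap hs ht (openCone_comm j k t ▸ hst) h_le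

theorem GeneralPosition.forwardingRule_router (hP : GeneralPosition P) (hs : s ∈ P) (ht : t ∈ P)
    (hne : s ≠ t) :
    ForwardingRule s t (kNeighborhood P 1 s) (router s t (kNeighborhood P 1 s)) := by
  have h_exists := hP.exists_forwardingRule hs ht hne
  rw [router, dif_pos h_exists]
  exact h_exists.choose_spec

end Triangle

/-! ### Length of the routes -/

/-- `φ` is an upper bound for the length of the route from `u` to `t`, as maintained along the
route. Its amount depends on where `t` lies and, for `t` in a negative cone of `u`, on whether a
side of the canonical triangle is known to be empty. -/
inductive IsBudget (P : Finset Plane) (t u : Plane) (φ : ℝ) : Prop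
  | arrived (h : u = t) (hφ : 0 ≤ φ)
  | positive {i j k : Fin 3} (h : Distinct i j k) (ht : t ∈ openCone j k u)
      (hj : coord i t - coord i u + (coord j u - coord j t) ≤ φ)
      (hk : coord i t - coord i u + (coord k u - coord k t) ≤ φ)
  | emptySide {i j k : Fin 3} (h : Distinct i j k) (hu : u ∈ openCone j k t)
      (h_side : ∀ x ∈ P, x ∉ side u t i j k)
      (hφ : coord i u - coord i t + (coord j t - coord j u) ≤ φ)
  | negative {i j k : Fin 3} (h : Distinct i j k) (hu : u ∈ openCone j k t)
      (hφ : 2 * (coord i u - coord i t) + (coord j t - coord j u) ≤ φ)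

section Budget

variable {P : Finset Plane} {i j k : Fin 3} {t u w : Plane} {φ : ℝ}

theorem IsBudget.nonneg (hφ : IsBudget P t u φ) : 0 ≤ φ := by
  rcases hφ with ⟨-, hφ⟩ | ⟨h, ht, hφ, -⟩ | ⟨h, hu, -, hφ⟩ | ⟨h, hu, hφ⟩
  · exact hφ
  · linarith [coord_lt_of_mem_openCone h ht, ht.1]
  · linarith [coord_lt_of_mem_openCone h hu, hu.1]
  · linarith [coord_lt_of_mem_openCone h hu, hu.1]

theorem IsBudget.le_of_mem_openCone (hφ : IsBudget P t u φ) (h : Distinct i j k)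
    (ht : t ∈ openCone j k u) :
    coord i t - coord i u + (coord j u - coord j t) ≤ φ ∧
      coord i t - coord i u + (coord k u - coord k t) ≤ φ := by
  rcases hφ with ⟨rfl, -⟩ | ⟨h', ht', hj, hk⟩ | ⟨h', hu, -, -⟩ | ⟨h', hu, -⟩
  · exact absurd rfl (ne_of_mem_openCone ht)
  · rcases eq_or_eq_swap_of_mem_openCone h h' ht ht' with ⟨rfl, ⟨rfl, rfl⟩ | ⟨rfl, rfl⟩⟩
    · exact ⟨hj, hk⟩
    · exact ⟨hk, hj⟩
  · exact absurd hu (notMem_openCone_of_mem h h' ht)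
  · exact absurd hu (notMem_openCone_of_mem h h' ht)

theorem IsBudget.cases_of_mem_openCone (hφ : IsBudget P t u φ) (h : Distinct i j k)
    (hu : u ∈ openCone j k t) :
    (∀ x ∈ P, x ∉ side u t i j k) ∧ coord i u - coord i t + (coord j t - coord j u) ≤ φ ∨
      (∀ x ∈ P, x ∉ side u t i k j) ∧ coord i u - coord i t + (coord k t - coord k u) ≤ φ ∨
      2 * (coord i u - coord i t) + min (coord j t - coord j u) (coord k t - coord k u) ≤ φ := by
  rcases hφ with ⟨rfl, -⟩ | ⟨h', ht, -, -⟩ | ⟨h', hu', h_side, hφ⟩ | ⟨h', hu', hφ⟩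
  · exact absurd rfl (ne_of_mem_openCone hu)
  · exact absurd ht (notMem_openCone_of_mem h h' hu)
  · rcases eq_or_eq_swap_of_mem_openCone h h' hu hu' with ⟨rfl, ⟨rfl, rfl⟩ | ⟨rfl, rfl⟩⟩
    · exact .inl ⟨h_side, hφ⟩
    · exact .inr (.inl ⟨h_side, hφ⟩)
  · refine .inr (.inr ?_)
    rcases eq_or_eq_swap_of_mem_openCone h h' hu hu' with ⟨rfl, ⟨rfl, rfl⟩ | ⟨rfl, rfl⟩⟩
    · exact (add_le_add_right (min_le_left _ _) _).trans hφ
    · exact (add_le_add_right (min_le_right _ _) _).trans hφ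

theorem IsBudget.le_of_forall_notMem_side (hφ : IsBudget P t u φ) (h : Distinct i j k)
    (hu : u ∈ openCone j k t)
    (h_other : (∃ x ∈ P, x ∈ side u t i k j) ∨ coord j t - coord j u ≤ coord k t - coord k u) :
    coord i u - coord i t + (coord j t - coord j u) ≤ φ := by
  have hj := hu.1
  have hk := hu.2
  rcases hφ.cases_of_mem_openCone h hu with ⟨-, hφ⟩ | ⟨h_empty, hφ⟩ | hφ
  · exact hφ
  · have h_le := h_other.resolve_left fun ⟨x, hx, hxs⟩ => h_empty x hx hxs
    linarith
  · have h_min := le_min (sub_nonneg.2 hj.le) (sub_nonneg.2 hk.le)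
    linarith [coord_add_add h t, coord_add_add h u]

theorem IsBudget.of_passed (h : Distinct i j k) (hw : w ∈ openCone j k u)
    (h_closest : ∀ x ∈ P, x ∈ openCone j k u → coord i w ≤ coord i x)
    (hwi : coord i w < coord i t) (hwj : coord j w < coord j t) (htj : coord j t < coord j u)
    (hφ : coord i t - coord i u + (coord k u - coord k t) ≤ φ) :
    IsBudget P t w (φ - dist u w) := by
  have h_dist := dist_le_of_mem_openCone h hw
  have hwk : coord k w < coord k u := hw.2
  refine .emptySide h.rotate.rotate ⟨hwi, hwj⟩ ?_ (by linarith)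
  rintro x hx ⟨⟨hxk, hxi⟩, hxj⟩
  exact hxi.not_ge (h_closest x hx ⟨hxj.trans_lt htj, hxk.trans hwk⟩)

theorem IsBudget.of_mem_openCone (hP : GeneralPosition P) (h : Distinct i j k) (ht : t ∈ P)
    (htu : t ∈ openCone j k u) (hwP : w ∈ P) (hw : w ∈ openCone j k u)
    (h_closest : ∀ x ∈ P, x ∈ openCone j k u → coord i w ≤ coord i x)
    (hj : coord i t - coord i u + (coord j u - coord j t) ≤ φ)
    (hk : coord i t - coord i u + (coord k u - coord k t) ≤ φ) :
    IsBudget P t w (φ - dist u w) := by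
  have h_dist := dist_le_of_mem_openCone h hw
  rcases eq_or_ne w t with rfl | hne
  · exact .arrived rfl (by linarith [hw.1])
  have hwi := hP.coord_lt_of_le hwP ht hne (h_closest t ht htu)
  rcases lt_or_ge (coord j w) (coord j t) with hwj | hwj
  · exact .of_passed h hw h_closest hwi hwj htu.1 hk
  rcases lt_or_ge (coord k w) (coord k t) with hwk | hwk
  · exact .of_passed h.swap (And.symm hw) (by rwa [openCone_comm]) hwi hwk htu.2 hj
  · exact .positive h ⟨hP.coord_lt_of_le ht hwP hne.symm hwj,
      hP.coord_lt_of_le ht hwP hne.symm hwk⟩ (by linarith [hw.1]) (by linarith [hw.2])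

theorem IsBudget.of_emptySide (hP : GeneralPosition P) (h : Distinct i j k) (hu : u ∈ P)
    (ht : t ∈ P) (hwP : w ∈ P) (h_side : ∀ x ∈ kNeighborhood P 1 u, x ∉ side u t i j k)
    (hwi : coord i w < coord i u) (hwj : coord j w ≤ coord j t) (hwk : coord k w ≤ coord k t)
    (h_cone : ∀ x ∈ P, x ∈ openCone i k u → coord j w ≤ coord j x)
    (h_min : ∀ x ∈ kNeighborhood P 1 u, x ∈ middle u t j k → coord j w ≤ coord j x)
    (h_dist : dist u w ≤ coord i u - coord i w + (coord j w - coord j u))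
    (hφ : coord i u - coord i t + (coord j t - coord j u) ≤ φ) :
    IsBudget P t w (φ - dist u w) := by
  rcases eq_or_ne w t with rfl | hne
  · exact .arrived rfl (by linarith)
  · exact .emptySide h ⟨hP.coord_lt_of_le hwP ht hne hwj, hP.coord_lt_of_le hwP ht hne hwk⟩
      (hP.forall_notMem_side_of_le h hu ((hP.forall_notMem_side_iff h hu).1 h_side) hwi hwj h_cone
        h_min)
      (by linarith)

theorem IsBudget.of_mem_side (hP : GeneralPosition P) (h : Distinct i j k) (ht : t ∈ P)
    (hu : u ∈ openCone j k t) (hwP : w ∈ P) (hw : w ∈ side u t i k j)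
    (hφ : 2 * (coord i u - coord i t) + (coord j t - coord j u) ≤ φ) :
    IsBudget P t w (φ - dist u w) := by
  have h_dist := dist_le_of_mem_openCone h.rotate hw.1.symm
  have hwk : coord k w < coord k t := hw.1.2.trans hu.2
  have hne : w ≠ t := by rintro rfl; exact lt_irrefl _ hwk
  have hi := hw.1.1
  exact .negative h ⟨hP.coord_lt_of_le hwP ht hne hw.2, hwk⟩ (by linarith)

theorem ForwardingRule.isBudget (hP : GeneralPosition P) (hu : u ∈ P) (ht : t ∈ P)
    (hφ : IsBudget P t u φ) (hw : ForwardingRule u t (kNeighborhood P 1 u) w) :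
    IsBudget P t w (φ - dist u w) := by
  have hadj := hw.adj
  have hwP := mem_of_adj hadj
  rcases hw with ⟨h, htu, -, hw⟩ | ⟨h, hut, h_large, h_le, -, hw⟩ |
    ⟨h, hut, h_side, h_other, -, hw, h_min⟩ | ⟨h, hut, h_side, h_middle, -, hw⟩
  · obtain ⟨hj, hk⟩ := hφ.le_of_mem_openCone h htu
    have h_closest := (hP.adj_iff_forall_coord_le h hu hwP hw).1 hadj
    exact .of_mem_openCone hP h ht htu hwP hw h_closest hj hk
  · refine .of_mem_side hP h ht hut hwP hw ?_
    rcases hφ.cases_of_mem_openCone h hut with ⟨h_empty, -⟩ | ⟨h_empty, -⟩ | hφ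
    · obtain ⟨x, hN, hx⟩ := h_large
      exact absurd hx (h_empty x (kNeighborhood_subset hu 1 hN))
    · exact absurd hw (h_empty w hwP)
    · rwa [min_eq_left h_le] at hφ
  · have h_closest := (hP.adj_iff_forall_coord_le h hwP hu hw.1).1 hadj.symm
    have h_dist := dist_le_of_mem_openCone h hw.1
    rw [dist_comm] at h_dist
    refine .of_emptySide hP h hu ht hwP h_side (coord_lt_of_mem_openCone h hw.1) hw.2.1 hw.2.2
      (fun x hx hxu => ?_) h_min (by linarith [hw.1.1])
      (hφ.le_of_forall_notMem_side h hut <|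
        h_other.imp_left fun ⟨x, hN, hx⟩ => ⟨x, kNeighborhood_subset hu 1 hN, hx⟩)
    exact not_lt.1 fun hxw => hxu.1.not_ge (h_closest x hx ⟨hxw, hxu.2.trans hw.1.2⟩)
  · have h_closest := (hP.adj_iff_forall_coord_le h.rotate hu hwP hw.1.symm).1 hadj
    have h_dist := dist_le_of_mem_openCone h.rotate hw.1.symm
    exact .of_emptySide hP h hu ht hwP h_side hw.1.1 hw.2 (hw.1.2.trans hut.2).le
      (fun x hx hxu => h_closest x hx hxu.symm) (fun x hN hx => absurd hx (h_middle x hN))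
      (by linarith [hw.1.1]) (hφ.le_of_forall_notMem_side h hut (.inl ⟨w, hwP, hw⟩))

end Budget

section Delivery

variable {k : ℕ} {A : RoutingAlgorithm} {P : Finset Plane} {s t : Plane} {L L' : ℝ}

theorem position_zero : position k A P s t 0 = s :=
  rfl

theorem position_succ (n : ℕ) :
    position k A P s t (n + 1) = position k A P (A s t (kNeighborhood P k s)) t n :=
  Function.iterate_succ_apply _ n s

theorem deliversWithin_self (hL : 0 ≤ L) : DeliversWithin k A P t t L :=
  ⟨0, rfl, fun _ hi => absurd hi (Nat.not_lt_zero _), by simpa using hL⟩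

theorem deliversWithin_iff_of_ne (hne : s ≠ t) :
    DeliversWithin k A P s t L ↔ (halfThetaSix P).Adj s (A s t (kNeighborhood P k s)) ∧
      DeliversWithin k A P (A s t (kNeighborhood P k s)) t
        (L - dist s (A s t (kNeighborhood P k s))) := by
  constructor
  · rintro ⟨_ | n, h_end, h_adj, h_le⟩
    · exact absurd h_end hne
    rw [Finset.sum_range_succ'] at h_le
    simp only [position_succ, position_zero] at h_end h_le
    refine ⟨(h_adj 0 n.succ_pos).2, n, h_end, fun i hi => ?_, le_sub_iff_add_le.2 h_le⟩
    simpa only [position_succ] using h_adj (i + 1) (Nat.succ_lt_succ hi)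
  · rintro ⟨h_first, n, h_end, h_adj, h_le⟩
    refine ⟨n + 1, by rw [position_succ, h_end], fun i hi => ?_, ?_⟩
    · cases i with
      | zero => exact ⟨hne, h_first⟩
      | succ i => simpa only [position_succ] using h_adj i (Nat.lt_of_succ_lt_succ hi)
    · rw [Finset.sum_range_succ']
      simpa only [position_succ, position_zero] using le_sub_iff_add_le.1 h_le

theorem DeliversWithin.mono (h : DeliversWithin k A P s t L) (hL : L ≤ L') :
    DeliversWithin k A P s t L' := by
  obtain ⟨n, h_end, h_adj, h_le⟩ := h
  exact ⟨n, h_end, h_adj, h_le.trans hL⟩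

theorem exists_pos_le_dist {X : Type*} [MetricSpace X] (P : Finset X) :
    ∃ δ > 0, ∀ p ∈ P, ∀ q ∈ P, p ≠ q → δ ≤ dist p q := by
  obtain ⟨δ, hδ, h_lt⟩ := ENNReal.lt_iff_exists_nnreal_btwn.1 P.finite_toSet.einfsep_pos
  refine ⟨δ, by exact_mod_cast hδ, fun p hp q hq hpq => ?_⟩
  have h_le := h_lt.le.trans (Set.einfsep_le_edist_of_mem hp hq hpq)
  rwa [edist_nndist, ENNReal.coe_le_coe] at h_le

/-- Since the steps have a positive minimum length, the budget is exhausted after finitely many of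
them. -/
theorem deliversWithin_of_budget (B : Plane → ℝ → Prop) (h_nonneg : ∀ u φ, B u φ → 0 ≤ φ)
    (h_step : ∀ u ∈ P, u ≠ t → ∀ φ, B u φ →
      (halfThetaSix P).Adj u (A u t (kNeighborhood P k u)) ∧
        B (A u t (kNeighborhood P k u)) (φ - dist u (A u t (kNeighborhood P k u))))
    (hs : s ∈ P) (hL : B s L) : DeliversWithin k A P s t L := by
  obtain ⟨δ, hδ, h_dist⟩ := exists_pos_le_dist P
  obtain ⟨n, hn⟩ := exists_nat_gt (L / δ)
  rw [div_lt_iff₀ hδ] at hn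
  induction n generalizing s L with
  | zero => exact absurd hn (by simpa using h_nonneg s L hL)
  | succ n ih =>
    rcases eq_or_ne s t with rfl | hne
    · exact deliversWithin_self (h_nonneg s L hL)
    obtain ⟨hadj, hB⟩ := h_step s hs hne L hL
    have hδ_le := h_dist _ hs _ (mem_of_adj hadj) hadj.ne
    push_cast at hn
    exact (deliversWithin_iff_of_ne hne).2 ⟨hadj, ih (mem_of_adj hadj) hB (by linarith)⟩

end Delivery

section Competitive

variable {P : Finset Plane} {s t : Plane}

theorem IsBudget.deliversWithin_router {φ : ℝ} (hφ : IsBudget P t s φ) (hP : GeneralPosition P)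
    (hs : s ∈ P) (ht : t ∈ P) : DeliversWithin 1 router P s t φ :=
  deliversWithin_of_budget (IsBudget P t) (fun _ _ => IsBudget.nonneg)
    (fun _ hu hne _ hφ =>
      have h_rule := hP.forwardingRule_router hu ht hne
      ⟨h_rule.adj, h_rule.isBudget hP hu ht hφ⟩)
    hs hφ

theorem isBudget_two_mul_dist {i j k : Fin 3} (h : Distinct i j k) (ht : t ∈ openCone j k s) :
    IsBudget P t s (2 * dist s t) := by
  have hi : coord i t - coord i s = (coord j s - coord j t) + (coord k s - coord k t) := by
    linarith [coord_add_add h s, coord_add_add h t]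
  refine .positive h ht ?_ ?_ <;> refine le_of_sq_le_sq ?_ (by positivity) <;>
    rw [mul_pow, dist_sq_eq h, hi]
  · nlinarith [sq_nonneg (coord k s - coord k t)]
  · nlinarith [sq_nonneg (coord j s - coord j t)]

theorem isBudget_five_div_sqrt_three_mul_dist {i j k : Fin 3} (h : Distinct i j k)
    (hs : s ∈ openCone j k t) : IsBudget P t s (5 / √3 * dist s t) := by
  wlog h_le : coord j t - coord j s ≤ coord k t - coord k s generalizing j k
  · exact this h.swap hs.symm (le_of_not_ge h_le)
  have hi : coord i s - coord i t = (coord j t - coord j s) + (coord k t - coord k s) := by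
    linarith [coord_add_add h s, coord_add_add h t]
  have h_pos : 0 ≤ 2 * (coord j t - coord j s) + 13 * (coord k t - coord k s) := by
    linarith [hs.1, hs.2]
  refine .negative h hs (le_of_sq_le_sq ?_ (by positivity))
  rw [mul_pow, dist_sq_eq h, hi, div_pow, Real.sq_sqrt (by norm_num)]
  nlinarith [mul_nonneg h_pos (sub_nonneg.2 h_le)]

theorem isCompetitive_router_inPositiveCone : IsCompetitive 1 router InPositiveCone 2 := by
  intro P hP s hs t ht hne hst
  obtain ⟨i, j, k, h, hts⟩ := hP.exists_mem_openCone_of_inPositiveCone hs ht hne.symm hst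
  exact (isBudget_two_mul_dist h hts).deliversWithin_router hP hs ht

theorem isCompetitive_router_inNegativeCone :
    IsCompetitive 1 router InNegativeCone (5 / √3) := by
  intro P hP s hs t ht hne hst
  obtain ⟨i, j, k, h, hst⟩ := hP.exists_mem_openCone_of_inPositiveCone ht hs hne
    ((inNegativeCone_iff s t).1 hst)
  exact (isBudget_five_div_sqrt_three_mul_dist h hst).deliversWithin_router hP hs ht

theorem two_lt_five_div_sqrt_three : (2 : ℝ) < 5 / √3 := by
  rw [lt_div_iff₀ (by positivity), ← lt_div_iff₀' (by norm_num), Real.sqrt_lt' (by norm_num)]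
  norm_num

theorem isCompetitive_router : IsCompetitive 1 router (fun _ _ => True) (5 / √3) := by
  intro P hP s hs t ht hne _
  rcases inPositiveCone_or_inNegativeCone s t with hst | hst
  · exact (isCompetitive_router_inPositiveCone P hP s hs t ht hne hst).mono
      (mul_le_mul_of_nonneg_right two_lt_five_div_sqrt_three.le dist_nonneg)
  · exact isCompetitive_router_inNegativeCone P hP s hs t ht hne hst

end Competitive

/-! ### Walks in geometric graphs -/

section Walks

variable {G : SimpleGraph Plane} {u v w : Plane}

theorem walkLength_cons (h : G.Adj u v) (p : G.Walk v w) :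
    walkLength (p.cons h) = dist u v + walkLength p := by
  simp [walkLength]

theorem walkLength_concat (p : G.Walk u v) (h : G.Adj v w) :
    walkLength (p.concat h) = walkLength p + dist v w := by
  simp [walkLength]

theorem walkLength_reverse (p : G.Walk u v) : walkLength p.reverse = walkLength p := by
  simp [walkLength, Function.comp_def, dist_comm]

theorem dist_le_walkLength (p : G.Walk u v) : dist u v ≤ walkLength p := by
  induction p with
  | nil => simp [walkLength]
  | cons h p ih =>
    rw [walkLength_cons]
    exact (dist_triangle _ _ _).trans (add_le_add_right ih _)

theorem dist_add_dist_le_walkLength (h_adj : ∀ x, G.Adj x w → x = v) (hne : u ≠ w)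
    (p : G.Walk u w) : dist u v + dist v w ≤ walkLength p := by
  have h_nil : ¬p.Nil := SimpleGraph.Walk.not_nil_of_ne hne
  have h_penultimate := p.adj_penultimate h_nil
  rw [← p.concat_dropLast h_penultimate, walkLength_concat, ← h_adj _ h_penultimate]
  exact add_le_add_left (dist_le_walkLength _) _

theorem exists_walk_of_forall_adj (f : ℕ → Plane) (n : ℕ) (h : ∀ i < n, G.Adj (f i) (f (i + 1))) :
    ∃ p : G.Walk (f 0) (f n), walkLength p = ∑ i ∈ Finset.range n, dist (f i) (f (i + 1)) := by
  induction n with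
  | zero => exact ⟨.nil, by simp [walkLength]⟩
  | succ n ih =>
    obtain ⟨p, hp⟩ := ih fun i hi => h i (hi.trans n.lt_succ_self)
    exact ⟨p.concat (h n n.lt_succ_self), by rw [walkLength_concat, hp, Finset.sum_range_succ]⟩

theorem graphDist_comm (u v : Plane) : graphDist G u v = graphDist G v u := by
  have h_le (u v : Plane) : graphDist G u v ≤ graphDist G v u :=
    le_iInf fun p => (iInf_le _ p.reverse).trans_eq (by rw [walkLength_reverse])
  exact (h_le u v).antisymm (h_le v u)

theorem DeliversWithin.exists_walk {k : ℕ} {A : RoutingAlgorithm} {P : Finset Plane} {s t : Plane}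
    {L : ℝ} (h : DeliversWithin k A P s t L) :
    ∃ p : (halfThetaSix P).Walk s t, walkLength p ≤ L := by
  obtain ⟨n, h_end, h_adj, h_le⟩ := h
  obtain ⟨p, hp⟩ := exists_walk_of_forall_adj (position k A P s t) n fun i hi => (h_adj i hi).2
  refine ⟨p.copy position_zero h_end, ?_⟩
  rw [walkLength, SimpleGraph.Walk.darts_copy]
  exact hp.trans_le h_le

theorem IsCompetitive.graphDist_le {k : ℕ} {A : RoutingAlgorithm} {R : Plane → Plane → Prop} {d : ℝ}
    (hA : IsCompetitive k A R d) {P : Finset Plane} (hP : GeneralPosition P) {s t : Plane}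
    (hs : s ∈ P) (ht : t ∈ P) (hne : s ≠ t) (hst : R s t) :
    graphDist (halfThetaSix P) s t ≤ ENNReal.ofReal (d * dist s t) := by
  obtain ⟨p, hp⟩ := (hA P hP s hs t ht hne hst).exists_walk
  exact (iInf_le _ p).trans (ENNReal.ofReal_le_ofReal hp)

end Walks

/-! ### Lower bound for positive cones and the spanning ratio -/

theorem le_of_forall_sub_mul_le {a b c d : ℝ} (hc : 0 < c)
    (h : ∀ ε, 0 < ε → ε ≤ c → a - b * ε ≤ d) : a ≤ d := by
  have h_tendsto : Filter.Tendsto (fun ε => a - b * ε) (nhdsWithin 0 (Set.Ioi 0)) (nhds a) := by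
    have h_cont : Continuous fun ε => a - b * ε := by fun_prop
    simpa using (h_cont.tendsto 0).mono_left nhdsWithin_le_nhds
  refine le_of_tendsto h_tendsto ?_
  filter_upwards [Ioc_mem_nhdsGT hc] with ε hε using h ε hε.1 hε.2

/-- The point whose coordinates with indices `1` and `2` are `x` and `y`. -/
def ofCoords (x y : ℝ) : Plane := !₂[(y - x) / 2, -(√3 / 2) * (x + y)]

theorem coord_ofCoords (i : Fin 3) (x y : ℝ) : coord i (ofCoords x y) = ![-x - y, x, y] i := by
  have h_sqrt : √3 ≠ 0 := by positivity
  rw [coord_apply]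
  fin_cases i <;>
    simp only [ofCoords, Fin.zero_eta, Fin.mk_one, Fin.reduceFinMk, Matrix.cons_val] <;>
    field_simp <;> ring

section Detour

variable {ε : ℝ}

/-- The target of the lower bound construction for positive cones. From the origin it lies near a
corner of its canonical triangle. -/
def detourTarget (ε : ℝ) : Plane := ofCoords (-ε) (-1 + ε)

/-- The intermediate point of the lower bound construction for positive cones. From the origin it
lies near the corner of the canonical triangle opposite to the one near `detourTarget`. -/
def detourVia (ε : ℝ) : Plane := ofCoords (-1 + 2 * ε) (-ε)

open Classical in
/-- A point set on which the shortest path from the origin to `detourTarget` goes through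
`detourVia`. -/
def detourSet (ε : ℝ) : Finset Plane := {0, detourTarget ε, detourVia ε}

theorem mem_detourSet {x : Plane} :
    x ∈ detourSet ε ↔ x = 0 ∨ x = detourTarget ε ∨ x = detourVia ε := by
  simp [detourSet]

theorem coord_detourTarget (i : Fin 3) : coord i (detourTarget ε) = ![1, -ε, -1 + ε] i := by
  rw [detourTarget, coord_ofCoords, show -(-ε) - (-1 + ε) = 1 by ring]

theorem coord_detourVia (i : Fin 3) : coord i (detourVia ε) = ![1 - ε, -1 + 2 * ε, -ε] i := by
  rw [detourVia, coord_ofCoords, show -(-1 + 2 * ε) - -ε = 1 - ε by ring]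

theorem generalPosition_detourSet (hε : 0 < ε) (hε' : ε ≤ 1 / 10) :
    GeneralPosition (detourSet ε) := by
  rw [generalPosition_iff_injOn]
  intro i p hp q hq h_eq
  rcases mem_detourSet.1 hp with rfl | rfl | rfl <;>
    rcases mem_detourSet.1 hq with rfl | rfl | rfl <;>
    first
    | rfl
    | exfalso
      simp only [map_zero, coord_detourTarget, coord_detourVia] at h_eq
      fin_cases i <;>
        simp only [Fin.zero_eta, Fin.mk_one, Fin.reduceFinMk, Matrix.cons_val] at h_eq <;>
        linarith

theorem detourTarget_mem_openCone (hε : 0 < ε) (hε' : ε ≤ 1 / 10) :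
    detourTarget ε ∈ openCone 1 2 0 := by
  rw [mem_openCone_iff]
  simp only [coord_detourTarget, map_zero, Matrix.cons_val]
  constructor <;> linarith

theorem detourVia_mem_openCone (hε : 0 < ε) (hε' : ε ≤ 1 / 10) :
    detourVia ε ∈ openCone 1 2 0 := by
  rw [mem_openCone_iff]
  simp only [coord_detourVia, map_zero, Matrix.cons_val]
  constructor <;> linarith

theorem eq_detourVia_of_adj (hε : 0 < ε) (hε' : ε ≤ 1 / 10) {x : Plane}
    (h_adj : (halfThetaSix (detourSet ε)).Adj x (detourTarget ε)) : x = detourVia ε := by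
  rcases mem_detourSet.1 (mem_of_adj h_adj.symm) with rfl | rfl | rfl
  · have h_closest := ((generalPosition_detourSet hε hε').adj_iff_forall_coord_le
      (distinct_add_one_add_two 0) (mem_of_adj h_adj.symm) (mem_of_adj h_adj)
      (detourTarget_mem_openCone hε hε')).1 h_adj
    have h_le := h_closest (detourVia ε) (mem_detourSet.2 (.inr (.inr rfl)))
      (detourVia_mem_openCone hε hε')
    simp only [coord_detourTarget, coord_detourVia, Matrix.cons_val] at h_le
    linarith
  · exact absurd rfl h_adj.ne
  · rfl

theorem two_sub_le_graphDist_detourTarget (hε : 0 < ε) (hε' : ε ≤ 1 / 10) :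
    ENNReal.ofReal (2 - 4 * ε) ≤ graphDist (halfThetaSix (detourSet ε)) 0 (detourTarget ε) := by
  refine le_iInf fun p => ENNReal.ofReal_le_ofReal ?_
  have h_via := dist_add_dist_le_walkLength (fun _ => eq_detourVia_of_adj hε hε')
    (ne_of_mem_openCone (detourTarget_mem_openCone hε hε')).symm p
  have h_first : ((coord 0 (detourVia ε) - coord 0 0) - (coord 1 (detourVia ε) - coord 1 0)) / 2 ≤
      dist 0 (detourVia ε) := half_sub_le_dist (distinct_add_one_add_two 2) 0 (detourVia ε)
  have h_last : ((coord 1 (detourTarget ε) - coord 1 (detourVia ε)) -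
      (coord 2 (detourTarget ε) - coord 2 (detourVia ε))) / 2 ≤
      dist (detourVia ε) (detourTarget ε) :=
    half_sub_le_dist (distinct_add_one_add_two 0) (detourVia ε) (detourTarget ε)
  simp only [coord_detourTarget, coord_detourVia, map_zero, Matrix.cons_val] at h_first h_last
  linarith

theorem two_le_of_forall_graphDist_le {d : ℝ}
    (h : ∀ P : Finset Plane, GeneralPosition P → ∀ s ∈ P, ∀ t ∈ P, s ≠ t → InPositiveCone s t →
      graphDist (halfThetaSix P) s t ≤ ENNReal.ofReal (d * dist s t)) : 2 ≤ d := by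
  refine le_of_forall_sub_mul_le (b := 4) (c := 1 / 10) (by norm_num) fun ε hε hε' => ?_
  have h_mem := detourTarget_mem_openCone hε hε'
  have h_dist := dist_le_of_mem_openCone (distinct_add_one_add_two 0) h_mem
  have h_le := (two_sub_le_graphDist_detourTarget hε hε').trans <|
    h _ (generalPosition_detourSet hε hε') 0 (mem_detourSet.2 (.inl rfl)) _
      (mem_detourSet.2 (.inr (.inl rfl))) (ne_of_mem_openCone h_mem).symm
      ⟨0, (mem_positiveCone_iff (distinct_add_one_add_two 0)).2 ⟨h_mem.1.le, h_mem.2.le⟩⟩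
  simp only [coord_detourTarget, map_zero, Matrix.cons_val, sub_zero] at h_dist
  rw [ENNReal.ofReal_le_ofReal_iff'] at h_le
  have h_le := h_le.resolve_right (by linarith)
  have h_pos : 0 < d := pos_of_mul_pos_left (by linarith) dist_nonneg
  linarith [mul_le_of_le_one_right h_pos.le h_dist]

theorem IsCompetitive.two_le {k : ℕ} {A : RoutingAlgorithm} {d : ℝ}
    (hA : IsCompetitive k A InPositiveCone d) : 2 ≤ d :=
  two_le_of_forall_graphDist_le fun _ hP _ hs _ ht hne hst => hA.graphDist_le hP hs ht hne hst

theorem isSpanningRatio_two : IsSpanningRatio 2 := by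
  refine ⟨⟨by norm_num, fun P hP u hu v hv => ?_⟩, fun r hr =>
    two_le_of_forall_graphDist_le fun P hP s hs t ht _ _ => hr.2 P hP s hs t ht⟩
  rcases eq_or_ne u v with rfl | hne
  · exact (iInf_le _ .nil).trans (ENNReal.ofReal_le_ofReal (by simp [walkLength]))
  rcases inPositiveCone_or_inNegativeCone u v with huv | huv
  · exact isCompetitive_router_inPositiveCone.graphDist_le hP hu hv hne huv
  · rw [graphDist_comm, dist_comm]
    exact isCompetitive_router_inPositiveCone.graphDist_le hP hv hu hne.symm
      ((inNegativeCone_iff u v).1 huv)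

end Detour

/-! ### Lower bound for negative cones -/

section Zigzag

/-- The perturbation that brings the points `zigzag δ n` into general position. -/
def offset (δ : ℝ) (n : ℕ) : ℝ := δ / (n + 3)

/-- The source of the lower bound construction for negative cones, whose destination is the origin:
the midpoint of a side of the canonical triangle of the origin and the source. -/
def zigzagSource : Plane := ofCoords (-1 / 2) (-1 / 2)

/-- The index of the coordinate in which `zigzag δ n` is close to the origin. -/
def near (n : ℕ) : Fin 3 := if n % 2 = 0 then 2 else 1

/-- The index of the coordinate other than `0` in which `zigzag δ n` is far from the origin. -/
def far (n : ℕ) : Fin 3 := if n % 2 = 0 then 1 else 2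

/-- Points that alternate between the neighborhoods of the two corners other than the origin of the
canonical triangle of the origin and `zigzagSource`, and slowly approach the origin. -/
def zigzag (δ : ℝ) (n : ℕ) : Plane :=
  if n % 2 = 0 then ofCoords (-(1 - δ + offset δ n)) (-offset δ n)
  else ofCoords (-offset δ n) (-(1 - δ + offset δ n))

open Classical in
/-- The point set of the lower bound construction for negative cones. A message from `zigzagSource`
to the origin has to pass through `zigzag δ M`, and the local view of `zigzagSource` does not reveal
the parity of `M`. -/
def zigzagSet (δ : ℝ) (M : ℕ) : Finset Plane :=
  {0, zigzagSource} ∪ (Finset.range (M + 1)).image (zigzag δ)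

theorem offset_pos {δ : ℝ} (hδ : 0 < δ) (n : ℕ) : 0 < offset δ n := by
  unfold offset
  positivity

theorem strictAnti_offset {δ : ℝ} (hδ : 0 < δ) : StrictAnti (offset δ) := fun m n hmn => by
  unfold offset
  gcongr

theorem three_mul_offset_le {δ : ℝ} (hδ : 0 < δ) (n : ℕ) : 3 * offset δ n ≤ δ := by
  have h_le := (strictAnti_offset hδ).antitone (Nat.zero_le n)
  have h_zero : offset δ 0 = δ / 3 := by simp [offset]
  linarith

theorem distinct_near_far (n : ℕ) : Distinct 0 (near n) (far n) := by
  unfold Distinct near far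
  split_ifs <;> decide

theorem coord_zero_zigzag (δ : ℝ) (n : ℕ) : coord 0 (zigzag δ n) = 1 - δ + 2 * offset δ n := by
  unfold zigzag
  split_ifs <;> simp only [coord_ofCoords, Matrix.cons_val] <;> ring

theorem coord_near_zigzag (δ : ℝ) (m n : ℕ) : coord (near m) (zigzag δ n) =
    if m % 2 = n % 2 then -offset δ n else -(1 - δ + offset δ n) := by
  unfold zigzag near
  split_ifs <;> first | omega | simp only [coord_ofCoords, Matrix.cons_val]

theorem coord_far_zigzag (δ : ℝ) (m n : ℕ) : coord (far m) (zigzag δ n) =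
    if m % 2 = n % 2 then -(1 - δ + offset δ n) else -offset δ n := by
  unfold zigzag far
  split_ifs <;> first | omega | simp only [coord_ofCoords, Matrix.cons_val]

theorem coord_zero_zigzagSource : coord 0 zigzagSource = 1 := by
  rw [zigzagSource, coord_ofCoords, Matrix.cons_val_zero]
  norm_num

theorem coord_zigzagSource_of_ne_zero {i : Fin 3} (hi : i ≠ 0) : coord i zigzagSource = -1 / 2 := by
  rw [zigzagSource, coord_ofCoords]
  fin_cases i
  · exact absurd rfl hi
  · rfl
  · rfl

theorem coord_near_zigzagSource (n : ℕ) : coord (near n) zigzagSource = -1 / 2 :=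
  coord_zigzagSource_of_ne_zero (distinct_near_far n).1.symm

theorem coord_far_zigzagSource (n : ℕ) : coord (far n) zigzagSource = -1 / 2 :=
  coord_zigzagSource_of_ne_zero (distinct_near_far n).2.1.symm

variable {δ : ℝ} {M m n : ℕ} {x : Plane}

theorem mem_zigzagSet :
    x ∈ zigzagSet δ M ↔ x = 0 ∨ x = zigzagSource ∨ ∃ n ≤ M, zigzag δ n = x := by
  simp [zigzagSet]

theorem zero_mem_zigzagSet : 0 ∈ zigzagSet δ M :=
  mem_zigzagSet.2 (.inl rfl)

theorem zigzagSource_mem_zigzagSet : zigzagSource ∈ zigzagSet δ M :=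
  mem_zigzagSet.2 (.inr (.inl rfl))

theorem zigzag_mem_zigzagSet (hn : n ≤ M) : zigzag δ n ∈ zigzagSet δ M :=
  mem_zigzagSet.2 (.inr (.inr ⟨n, hn, rfl⟩))

theorem coord_zigzag_injective (hδ : δ ∈ Set.Ioc 0 (1 / 2)) (i : Fin 3) :
    Function.Injective fun n => coord i (zigzag δ n) := by
  intro m n h_eq
  have hm := three_mul_offset_le hδ.1 m
  have hn := three_mul_offset_le hδ.1 n
  have hm' := offset_pos hδ.1 m
  have hn' := offset_pos hδ.1 n
  refine (strictAnti_offset hδ.1).injective ?_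
  rcases (distinct_near_far m).eq_or i with rfl | rfl | rfl <;>
    simp only [coord_zero_zigzag, coord_near_zigzag, coord_far_zigzag, if_true] at h_eq <;>
    try split_ifs at h_eq
  all_goals linarith [hδ.2]

theorem coord_zigzag_ne_zero (hδ : δ ∈ Set.Ioc 0 (1 / 2)) (i : Fin 3) (n : ℕ) :
    coord i (zigzag δ n) ≠ 0 := by
  intro h_eq
  have h_pos := offset_pos hδ.1 n
  rcases (distinct_near_far n).eq_or i with rfl | rfl | rfl <;>
    simp only [coord_zero_zigzag, coord_near_zigzag, coord_far_zigzag, if_true] at h_eq <;>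
    linarith [hδ.2]

theorem coord_zigzagSource_ne_zero (i : Fin 3) : coord i zigzagSource ≠ 0 := by
  rcases eq_or_ne i 0 with rfl | hi
  · rw [coord_zero_zigzagSource]
    norm_num
  · rw [coord_zigzagSource_of_ne_zero hi]
    norm_num

theorem coord_zigzag_ne_coord_zigzagSource (hδ : δ ∈ Set.Ioc 0 (1 / 2)) (i : Fin 3) (n : ℕ) :
    coord i (zigzag δ n) ≠ coord i zigzagSource := by
  intro h_eq
  have h_pos := offset_pos hδ.1 n
  have h_le := three_mul_offset_le hδ.1 n
  rcases (distinct_near_far n).eq_or i with rfl | rfl | rfl <;>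
    simp only [coord_zero_zigzag, coord_near_zigzag, coord_far_zigzag, if_true,
      coord_zero_zigzagSource, coord_near_zigzagSource, coord_far_zigzagSource] at h_eq <;>
    linarith [hδ.2]

theorem generalPosition_zigzagSet (hδ : δ ∈ Set.Ioc 0 (1 / 2)) :
    GeneralPosition (zigzagSet δ M) := by
  rw [generalPosition_iff_injOn]
  intro i p hp q hq h_eq
  rcases mem_zigzagSet.1 hp with rfl | rfl | ⟨m, -, rfl⟩ <;>
    rcases mem_zigzagSet.1 hq with rfl | rfl | ⟨n, -, rfl⟩ <;>
    try simp only [map_zero] at h_eq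
  · rfl
  · exact absurd h_eq.symm (coord_zigzagSource_ne_zero i)
  · exact absurd h_eq.symm (coord_zigzag_ne_zero hδ i n)
  · exact absurd h_eq (coord_zigzagSource_ne_zero i)
  · rfl
  · exact absurd h_eq.symm (coord_zigzag_ne_coord_zigzagSource hδ i n)
  · exact absurd h_eq (coord_zigzag_ne_zero hδ i m)
  · exact absurd h_eq (coord_zigzag_ne_coord_zigzagSource hδ i m)
  · exact congrArg _ (coord_zigzag_injective hδ i h_eq)

theorem mem_openCone_zero (hδ : δ ∈ Set.Ioc 0 (1 / 2)) (hx : x ∈ zigzagSet δ M) (hne : x ≠ 0) :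
    x ∈ openCone 1 2 0 := by
  rw [mem_openCone_iff, map_zero, map_zero]
  rcases mem_zigzagSet.1 hx with rfl | rfl | ⟨n, -, rfl⟩
  · exact absurd rfl hne
  · rw [coord_zigzagSource_of_ne_zero (by decide), coord_zigzagSource_of_ne_zero (by decide)]
    norm_num
  · have h_pos := offset_pos hδ.1 n
    unfold zigzag
    split_ifs <;> simp only [coord_ofCoords, Matrix.cons_val] <;> constructor <;> linarith [hδ.2]

theorem mem_openCone_zigzagSource_iff (hδ : δ ∈ Set.Ioc 0 (1 / 2)) (hx : x ∈ zigzagSet δ M) :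
    x ∈ openCone 0 (far n) zigzagSource ↔ ∃ p ≤ M, n % 2 = p % 2 ∧ zigzag δ p = x := by
  rw [mem_openCone_iff, coord_zero_zigzagSource, coord_far_zigzagSource]
  constructor
  · rintro ⟨-, h_far⟩
    rcases mem_zigzagSet.1 hx with rfl | rfl | ⟨p, hp, rfl⟩
    · rw [map_zero] at h_far
      linarith
    · exact absurd h_far (coord_far_zigzagSource n).not_lt
    · refine ⟨p, hp, by_contra fun h_parity => ?_, rfl⟩
      rw [coord_far_zigzag, if_neg h_parity] at h_far
      linarith [three_mul_offset_le hδ.1 p, offset_pos hδ.1 p, hδ.2]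
  · rintro ⟨p, -, h_parity, rfl⟩
    rw [coord_zero_zigzag, coord_far_zigzag, if_pos h_parity]
    have h_pos := offset_pos hδ.1 p
    have h_le := three_mul_offset_le hδ.1 p
    constructor <;> linarith [hδ.2]

theorem mem_openCone_zero_near_zigzag_iff (hδ : δ ∈ Set.Ioc 0 (1 / 2)) (hx : x ∈ zigzagSet δ M) :
    x ∈ openCone 0 (near m) (zigzag δ m) ↔
      ∃ p ≤ M, m < p ∧ m % 2 ≠ p % 2 ∧ zigzag δ p = x := by
  have hm := offset_pos hδ.1 m
  have hm' := three_mul_offset_le hδ.1 m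
  rw [mem_openCone_iff, coord_zero_zigzag, coord_near_zigzag, if_pos rfl]
  constructor
  · rintro ⟨h_zero, h_near⟩
    rcases mem_zigzagSet.1 hx with rfl | rfl | ⟨p, hp, rfl⟩
    · rw [map_zero] at h_near
      linarith
    · rw [coord_zero_zigzagSource] at h_zero
      linarith
    · rw [coord_zero_zigzag] at h_zero
      refine ⟨p, hp, (strictAnti_offset hδ.1).lt_iff_gt.1 (by linarith), fun h_parity => ?_, rfl⟩
      rw [coord_near_zigzag, if_pos h_parity] at h_near
      linarith
  · rintro ⟨p, -, hmp, h_parity, rfl⟩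
    have h_lt := strictAnti_offset hδ.1 hmp
    have hp := offset_pos hδ.1 p
    rw [coord_zero_zigzag, coord_near_zigzag, if_neg h_parity]
    constructor <;> linarith [hδ.2]

theorem mem_openCone_near_far_zigzag_iff (hδ : δ ∈ Set.Ioc 0 (1 / 2)) (hx : x ∈ zigzagSet δ M) :
    x ∈ openCone (near n) (far n) (zigzag δ n) ↔
      ∃ p ≤ M, p < n ∧ n % 2 = p % 2 ∧ zigzag δ p = x := by
  have hn := offset_pos hδ.1 n
  have hn' := three_mul_offset_le hδ.1 n
  rw [mem_openCone_iff, coord_near_zigzag, coord_far_zigzag, if_pos rfl, if_pos rfl]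
  constructor
  · rintro ⟨h_near, h_far⟩
    rcases mem_zigzagSet.1 hx with rfl | rfl | ⟨p, hp, rfl⟩
    · rw [map_zero] at h_near
      linarith
    · rw [coord_far_zigzagSource] at h_far
      linarith [hδ.2]
    · have hp' := three_mul_offset_le hδ.1 p
      have hp'' := offset_pos hδ.1 p
      rw [coord_far_zigzag] at h_far
      split_ifs at h_far with h_parity
      · exact ⟨p, hp, (strictAnti_offset hδ.1).lt_iff_gt.1 (by linarith), h_parity, rfl⟩
      · linarith [hδ.2]
  · rintro ⟨p, -, hpn, h_parity, rfl⟩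
    have h_lt := strictAnti_offset hδ.1 hpn
    rw [coord_near_zigzag, coord_far_zigzag, if_pos h_parity, if_pos h_parity]
    constructor <;> linarith

theorem eq_zigzag_of_adj_zero (hδ : δ ∈ Set.Ioc 0 (1 / 2))
    (h_adj : (halfThetaSix (zigzagSet δ M)).Adj x 0) : x = zigzag δ M := by
  have hx := mem_of_adj h_adj.symm
  have h_closest := ((generalPosition_zigzagSet hδ).adj_iff_forall_coord_le
    (distinct_add_one_add_two 0) zero_mem_zigzagSet hx
    (mem_openCone_zero hδ hx h_adj.ne)).1 h_adj.symm
  have h_last : zigzag δ M ≠ 0 := fun h => coord_zigzag_ne_zero hδ 0 M (by rw [h, map_zero])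
  have h_le := h_closest _ (zigzag_mem_zigzagSet le_rfl)
    (mem_openCone_zero hδ (zigzag_mem_zigzagSet le_rfl) h_last)
  rw [coord_zero_zigzag] at h_le
  rcases mem_zigzagSet.1 hx with rfl | rfl | ⟨n, hn, rfl⟩
  · exact absurd rfl h_adj.ne
  · rw [coord_zero_zigzagSource] at h_le
    linarith [three_mul_offset_le hδ.1 M, hδ.1]
  · rw [coord_zero_zigzag] at h_le
    rw [hn.antisymm ((strictAnti_offset hδ.1).le_iff_ge.1 (by linarith))]

theorem adj_zigzagSource_zigzag_iff (hδ : δ ∈ Set.Ioc 0 (1 / 2)) (hn : n ≤ M) :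
    (halfThetaSix (zigzagSet δ M)).Adj zigzagSource (zigzag δ n) ↔ n ≤ 1 := by
  rw [(generalPosition_zigzagSet hδ).adj_iff_forall_coord_le (distinct_near_far n).rotate.swap
    zigzagSource_mem_zigzagSet (zigzag_mem_zigzagSet hn)
    ((mem_openCone_zigzagSource_iff hδ (zigzag_mem_zigzagSet hn)).2 ⟨n, hn, rfl, rfl⟩)]
  constructor
  · intro h_closest
    by_contra! h_gt
    have h_mem : zigzag δ (n - 2) ∈ zigzagSet δ M := zigzag_mem_zigzagSet (by omega)
    have h_le := h_closest _ h_mem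
      ((mem_openCone_zigzagSource_iff hδ h_mem).2 ⟨n - 2, by omega, by omega, rfl⟩)
    rw [coord_near_zigzag, coord_near_zigzag, if_pos rfl, if_pos (by omega)] at h_le
    exact h_le.not_gt (neg_lt_neg (strictAnti_offset hδ.1 (by omega)))
  · intro hn x hx hx_cone
    obtain ⟨p, -, h_parity, rfl⟩ := (mem_openCone_zigzagSource_iff hδ hx).1 hx_cone
    rw [coord_near_zigzag, coord_near_zigzag, if_pos rfl, if_pos h_parity]
    exact neg_le_neg ((strictAnti_offset hδ.1).antitone (by omega))

theorem le_add_two_of_adj_zigzag (hδ : δ ∈ Set.Ioc 0 (1 / 2)) (hn : n ≤ M)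
    (h_adj : (halfThetaSix (zigzagSet δ M)).Adj (zigzag δ m) (zigzag δ n)) : n ≤ m + 2 := by
  by_contra! h_gt
  have hP : GeneralPosition (zigzagSet δ M) := generalPosition_zigzagSet hδ
  have hm_mem : zigzag δ m ∈ zigzagSet δ M := zigzag_mem_zigzagSet (by omega)
  have hn_mem : zigzag δ n ∈ zigzagSet δ M := zigzag_mem_zigzagSet hn
  by_cases h_parity : m % 2 = n % 2
  · have h_mem : zigzag δ (m + 2) ∈ zigzagSet δ M := zigzag_mem_zigzagSet (by omega)
    have h_closest := (hP.adj_iff_forall_coord_le (distinct_near_far n) hn_mem hm_mem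
      ((mem_openCone_near_far_zigzag_iff hδ hm_mem).2
        ⟨m, by omega, by omega, h_parity.symm, rfl⟩)).1 h_adj.symm
    have h_le := h_closest _ h_mem
      ((mem_openCone_near_far_zigzag_iff hδ h_mem).2 ⟨m + 2, by omega, h_gt, by omega, rfl⟩)
    rw [coord_zero_zigzag, coord_zero_zigzag] at h_le
    linarith [strictAnti_offset hδ.1 (show m < m + 2 by omega)]
  · have h_mem : zigzag δ (m + 1) ∈ zigzagSet δ M := zigzag_mem_zigzagSet (by omega)
    have h_closest := (hP.adj_iff_forall_coord_le (distinct_near_far m).rotate.rotate hm_mem hn_mem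
      ((mem_openCone_zero_near_zigzag_iff hδ hn_mem).2
        ⟨n, hn, by omega, h_parity, rfl⟩)).1 h_adj
    have h_le := h_closest _ h_mem
      ((mem_openCone_zero_near_zigzag_iff hδ h_mem).2
        ⟨m + 1, by omega, by omega, by omega, rfl⟩)
    rw [coord_far_zigzag, coord_far_zigzag, if_neg h_parity, if_neg (by omega)] at h_le
    linarith [strictAnti_offset hδ.1 (show m + 1 < n by omega)]

theorem adj_zigzag_add_two (hδ : δ ∈ Set.Ioc 0 (1 / 2)) (hn : n + 2 ≤ M) :
    (halfThetaSix (zigzagSet δ M)).Adj (zigzag δ n) (zigzag δ (n + 2)) := by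
  have hn_mem : zigzag δ n ∈ zigzagSet δ M := zigzag_mem_zigzagSet (by omega)
  refine (((generalPosition_zigzagSet hδ).adj_iff_forall_coord_le (distinct_near_far (n + 2))
    (zigzag_mem_zigzagSet hn) hn_mem
    ((mem_openCone_near_far_zigzag_iff hδ hn_mem).2
      ⟨n, by omega, by omega, by omega, rfl⟩)).2 fun x hx hx_cone => ?_).symm
  obtain ⟨p, -, hpn, h_parity, rfl⟩ := (mem_openCone_near_far_zigzag_iff hδ hx).1 hx_cone
  have h_le := (strictAnti_offset hδ.1).antitone (show p ≤ n by omega)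
  rw [coord_zero_zigzag, coord_zero_zigzag]
  linarith

theorem exists_zigzag_eq_of_adj_zigzagSource (hδ : δ ∈ Set.Ioc 0 (1 / 2))
    (h_adj : (halfThetaSix (zigzagSet δ M)).Adj zigzagSource x) : ∃ n ≤ 1, zigzag δ n = x := by
  rcases mem_zigzagSet.1 (mem_of_adj h_adj) with rfl | rfl | ⟨n, hn, rfl⟩
  · exact absurd (congrArg (coord 0) (eq_zigzag_of_adj_zero hδ h_adj)).symm
      (coord_zigzag_ne_coord_zigzagSource hδ 0 M)
  · exact absurd rfl h_adj.ne
  · exact ⟨n, (adj_zigzagSource_zigzag_iff hδ hn).1 h_adj, rfl⟩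

theorem eq_zigzagSource_or_of_adj_zigzag (hδ : δ ∈ Set.Ioc 0 (1 / 2)) (hm : m < M)
    (h_adj : (halfThetaSix (zigzagSet δ M)).Adj (zigzag δ m) x) :
    x = zigzagSource ∨ ∃ n ≤ m + 2, zigzag δ n = x := by
  rcases mem_zigzagSet.1 (mem_of_adj h_adj) with rfl | rfl | ⟨n, hn, rfl⟩
  · exact absurd (coord_zigzag_injective hδ 0 (congrArg _ (eq_zigzag_of_adj_zero hδ h_adj))) hm.ne
  · exact .inl rfl
  · exact .inr ⟨n, le_add_two_of_adj_zigzag hδ hn h_adj, rfl⟩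

theorem kNeighborhood_zigzagSet {k : ℕ} (hδ : δ ∈ Set.Ioc 0 (1 / 2)) (hk : 2 * k ≤ M) :
    kNeighborhood (zigzagSet δ M) k zigzagSource =
      insert zigzagSource (zigzag δ '' Set.Iio (2 * k)) := by
  induction k with
  | zero =>
    ext v
    simp [mem_kNeighborhood_zero]
  | succ k ih =>
    ext v
    rw [mem_kNeighborhood_succ, ih (by omega)]
    constructor
    · rintro ((rfl | ⟨n, hn, rfl⟩) | ⟨w, rfl | ⟨m, hm, rfl⟩, h_adj⟩)
      · exact .inl rfl
      · exact .inr ⟨n, by rw [Set.mem_Iio] at *; omega, rfl⟩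
      · obtain ⟨n, hn, rfl⟩ := exists_zigzag_eq_of_adj_zigzagSource hδ h_adj
        exact .inr ⟨n, by rw [Set.mem_Iio]; omega, rfl⟩
      · rw [Set.mem_Iio] at hm
        refine (eq_zigzagSource_or_of_adj_zigzag hδ (by omega) h_adj).imp_right ?_
        rintro ⟨n, hn, rfl⟩
        exact ⟨n, by rw [Set.mem_Iio]; omega, rfl⟩
    · rintro (rfl | ⟨n, hn, rfl⟩)
      · exact .inl (.inl rfl)
      · rw [Set.mem_Iio] at hn
        refine .inr ?_
        rcases le_or_gt n 1 with hn' | hn'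
        · exact ⟨_, .inl rfl, (adj_zigzagSource_zigzag_iff hδ (by omega)).2 hn'⟩
        · obtain ⟨m, rfl⟩ := Nat.exists_eq_add_of_le' hn'
          exact ⟨_, .inr ⟨m, by rw [Set.mem_Iio]; omega, rfl⟩, adj_zigzag_add_two hδ (by omega)⟩

theorem half_mul_one_sub_le_dist_zigzagSource (δ : ℝ) (n : ℕ) :
    (1 - δ) / 2 ≤ dist zigzagSource (zigzag δ n) := by
  refine le_trans (le_of_eq ?_) (half_sub_le_dist (distinct_near_far n) zigzagSource (zigzag δ n))
  rw [coord_near_zigzag, coord_far_zigzag, if_pos rfl, if_pos rfl, coord_near_zigzagSource,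
    coord_far_zigzagSource]
  ring

theorem one_sub_le_dist_zigzag (δ : ℝ) (h_parity : n % 2 ≠ m % 2) :
    1 - δ ≤ dist (zigzag δ m) (zigzag δ n) := by
  refine le_trans (le_of_eq ?_)
    (half_sub_le_dist (distinct_near_far n) (zigzag δ m) (zigzag δ n))
  rw [coord_near_zigzag, coord_far_zigzag, coord_near_zigzag, coord_far_zigzag, if_pos rfl,
    if_pos rfl, if_neg h_parity, if_neg h_parity]
  ring

theorem one_sub_le_dist_zigzag_zero (hδ : 0 < δ) (n : ℕ) : 1 - δ ≤ dist (zigzag δ n) 0 := by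
  have h_dist := half_sub_le_dist (distinct_near_far n).rotate (zigzag δ n) 0
  rw [coord_far_zigzag, if_pos rfl, coord_zero_zigzag, map_zero, map_zero] at h_dist
  linarith [offset_pos hδ n]

theorem dist_zigzagSource_zero : dist zigzagSource 0 = √3 / 2 := by
  have h_sq : dist zigzagSource 0 ^ 2 = (√3 / 2) ^ 2 := by
    rw [dist_sq_eq (distinct_near_far 0), coord_near_zigzagSource, coord_far_zigzagSource, map_zero,
      map_zero, div_pow, Real.sq_sqrt (by norm_num)]
    norm_num
  exact (sq_eq_sq₀ dist_nonneg (by positivity)).1 h_sq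

theorem inNegativeCone_zigzagSource_zero : InNegativeCone zigzagSource 0 := by
  refine (inNegativeCone_iff _ _).2 ⟨0, (mem_positiveCone_iff (distinct_near_far 0)).2 ?_⟩
  rw [coord_near_zigzagSource, coord_far_zigzagSource, map_zero, map_zero]
  norm_num

theorem zigzagSource_ne_zero : zigzagSource ≠ 0 := fun h =>
  coord_zigzagSource_ne_zero 0 (by rw [h, map_zero])

theorem DeliversWithin.five_halves_mul_one_sub_le {k : ℕ} {A : RoutingAlgorithm} {L : ℝ}
    (h : DeliversWithin k A (zigzagSet δ M) zigzagSource 0 L) (hδ : δ ∈ Set.Ioc 0 (1 / 2))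
    (h_first : A zigzagSource 0 (kNeighborhood (zigzagSet δ M) k zigzagSource) = zigzag δ n)
    (h_parity : M % 2 ≠ n % 2) : 5 / 2 * (1 - δ) ≤ L := by
  obtain ⟨-, h_rest⟩ := (deliversWithin_iff_of_ne zigzagSource_ne_zero).1 h
  rw [h_first] at h_rest
  obtain ⟨p, hp⟩ := h_rest.exists_walk
  have h_ne : zigzag δ n ≠ 0 := fun h => coord_zigzag_ne_zero hδ 0 n (by rw [h, map_zero])
  have h_via := dist_add_dist_le_walkLength (fun _ => eq_zigzag_of_adj_zero hδ) h_ne p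
  linarith [half_mul_one_sub_le_dist_zigzagSource δ n, one_sub_le_dist_zigzag δ h_parity,
    one_sub_le_dist_zigzag_zero hδ.1 M]

theorem IsCompetitive.five_halves_mul_one_sub_le {k : ℕ} {A : RoutingAlgorithm} {d : ℝ}
    (hA : IsCompetitive k A InNegativeCone d) (hδ : δ ∈ Set.Ioc 0 (1 / 2)) :
    5 / 2 * (1 - δ) ≤ d * dist zigzagSource 0 := by
  have h_deliver (M : ℕ) : DeliversWithin k A (zigzagSet δ M) zigzagSource 0 _ :=
    hA _ (generalPosition_zigzagSet hδ) _ zigzagSource_mem_zigzagSet _ zero_mem_zigzagSet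
      zigzagSource_ne_zero inNegativeCone_zigzagSource_zero
  obtain ⟨n, hn, h_first⟩ := exists_zigzag_eq_of_adj_zigzagSource hδ
    ((deliversWithin_iff_of_ne zigzagSource_ne_zero).1 (h_deliver (2 * k))).1
  obtain ⟨M, hM, h_parity⟩ : ∃ M, 2 * k ≤ M ∧ M % 2 ≠ n % 2 :=
    ⟨2 * k + 1 - n, by omega, by omega⟩
  refine (h_deliver M).five_halves_mul_one_sub_le hδ ?_ h_parity
  rw [h_first, kNeighborhood_zigzagSet hδ le_rfl, kNeighborhood_zigzagSet hδ hM]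

theorem IsCompetitive.five_div_sqrt_three_le {k : ℕ} {A : RoutingAlgorithm} {d : ℝ}
    (hA : IsCompetitive k A InNegativeCone d) : 5 / √3 ≤ d := by
  have h_le : 5 / 2 ≤ d * (√3 / 2) := by
    refine le_of_forall_sub_mul_le (b := 5 / 2) (c := 1 / 2) (by norm_num) fun δ hδ hδ' => ?_
    rw [← dist_zigzagSource_zero]
    linarith [hA.five_halves_mul_one_sub_le ⟨hδ, hδ'⟩]
  rw [div_le_iff₀ (by positivity)]
  linarith

end Zigzag

end HalfTheta

end

theorem mainTheorem4 :
    -- one `1`-local algorithm attains both ratios (and `5 / √3` over all pairs)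
    (∃ A : HalfTheta.RoutingAlgorithm,
      HalfTheta.HasRoutingRatio 1 A HalfTheta.InPositiveCone 2 ∧
      HalfTheta.HasRoutingRatio 1 A HalfTheta.InNegativeCone (5 / √3) ∧
      HalfTheta.HasRoutingRatio 1 A (fun _ _ => True) (5 / √3)) ∧
    -- both ratios are best possible for `k`-local algorithms
    (∀ (k : ℕ) (A : HalfTheta.RoutingAlgorithm) (d : ℝ),
      (HalfTheta.IsCompetitive k A HalfTheta.InPositiveCone d → 2 ≤ d) ∧
      (HalfTheta.IsCompetitive k A HalfTheta.InNegativeCone d → 5 / √3 ≤ d)) ∧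
    -- separation from the spanning ratio
    (HalfTheta.IsSpanningRatio 2 ∧ (2 : ℝ) < 5 / √3 ∧
      ∀ (k : ℕ) (A : HalfTheta.RoutingAlgorithm) (d : ℝ),
        HalfTheta.IsCompetitive k A (fun _ _ => True) d → 2 < d) := by
  have five_div_sqrt_three_le {k : ℕ} {A : HalfTheta.RoutingAlgorithm} {d : ℝ}
      (hA : HalfTheta.IsCompetitive k A (fun _ _ => True) d) : 5 / √3 ≤ d :=
    HalfTheta.IsCompetitive.five_div_sqrt_three_le fun P hP s hs t ht hne _ =>
      hA P hP s hs t ht hne trivial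
  refine ⟨⟨HalfTheta.router, ⟨?_, ?_⟩, ⟨?_, ?_⟩, ⟨?_, ?_⟩⟩, ?_, ?_, ?_, ?_⟩
  · exact HalfTheta.isCompetitive_router_inPositiveCone
  · exact fun d hd => hd.two_le
  · exact HalfTheta.isCompetitive_router_inNegativeCone
  · exact fun d hd => hd.five_div_sqrt_three_le
  · exact HalfTheta.isCompetitive_router
  · exact fun d hd => five_div_sqrt_three_le hd
  · exact fun k A d => ⟨fun hA => hA.two_le, fun hA => hA.five_div_sqrt_three_le⟩
  · exact HalfTheta.isSpanningRatio_two
  · exact HalfTheta.two_lt_five_div_sqrt_three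
  · exact fun k A d hA => HalfTheta.two_lt_five_div_sqrt_three.trans_le (five_div_sqrt_three_le hA)
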